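/- Let $A\subset\mathbb{R}^4$ be the set of the 24 vertices of the regular 24-cell, namely the 8 points $\pm 2e_i$ ($1\le i\le 4$) and the 16 points $(\pm1,\pm1,\pm1,\pm1)$, let $O$ be the origin of $\mathbb{R}^4$, and let $A_{50}=(A\cup\{O\})\times\{0,1\}\subset\mathbb{R}^5$. For real numbers $\alpha<0$ and $\beta>1$ let $A'_{50}$ be the point set obtained from $A_{50}$ by moving $(O,0)$ to $(O,\alpha)$ and $(O,1)$ to $(O,\beta)$. A triangulation of a finite point set $B\subset\mathbb{R}^d$ is a geometric simplicial complex with vertex set contained in $B$ that covers $\operatorname{conv}(B)$. A circuit of $B$ is an ordered pair $(Z^+,Z^-)$ of disjoint subsets of $B$ with intersecting convex hulls such that $Z=Z^+\cup Z^-$ is a minimal affinely dependent set; put $T_\pm(Z)=\{S\subseteq Z: Z^\pm\not\subseteq S\}$. If $T$ is a triangulation of $B$ that contains $T_+(Z)$ as a subcomplex, and all maximal simplices of $T_+(Z)$ have the same link $L$ in $T$, then replacing $T_+(Z)*L$ by $T_-(Z)*L$ in $T$ gives another triangulation of $B$, and this operation is called a (geometric bistellar) flip. The graph of triangulations of $B$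 has the triangulations of $B$ as vertices, two of them being adjacent if they differ by a flip. Then, for all $\alpha<0$ and $\beta>1$, the set $A'_{50}$ consists of 50 points and is in convex position (every point of it is a vertex of $\operatorname{conv}(A'_{50})$), and the graph of triangulations of $A'_{50}$ has at least 13 distinct connected components each of which contains at least $3^{48}$ triangulations. -/

import Mathlib

section Triangulations

variable {E : Type*} [AddCommGroup E] [Module ℝ E]

/-- A triangulation of the point set `A`: a geometric simplicial complex whose vertices belong to
`A` and which covers the convex hull of `A`. (Points of `A` need not all be used.) -/
def IsTriangulation (A : Set E) (K : Geometry.SimplicialComplex ℝ E) : Prop :=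
  K.vertices ⊆ A ∧ K.space = convexHull ℝ A

/-- The type of all triangulations of `A`. -/
abbrev Triangulation (A : Set E) : Type _ :=
  {K : Geometry.SimplicialComplex ℝ E // IsTriangulation A K}

/-- All simplices of `K`, the empty simplex included (Mathlib's `faces` are nonempty). -/
def allSimplices (K : Geometry.SimplicialComplex ℝ E) : Set (Finset E) :=
  insert ∅ K.faces

open Classical in
/-- `(P, N)` is a circuit of `A`: `Z = P ∪ N` is a minimal affinely dependent subset of `A`,
divided into two disjoint parts whose convex hulls intersect. -/
def IsCircuit (A : Set E) (P N : Finset E) : Prop :=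
  Disjoint P N ∧
  (↑(P ∪ N) : Set E) ⊆ A ∧
  ¬ AffineIndependent ℝ ((↑) : (P ∪ N : Finset E) → E) ∧
  (∀ W : Finset E, W ⊂ P ∪ N → AffineIndependent ℝ ((↑) : W → E)) ∧
  (convexHull ℝ (P : Set E) ∩ convexHull ℝ (N : Set E)).Nonempty

open Classical in
/-- The complex of all `S ⊆ P ∪ N` with `P ⊄ S`. For a circuit `(Z⁺, Z⁻)` this is `T₊(Z)` when
`(P, N) = (Z⁺, Z⁻)`, and `T₋(Z)` when `(P, N) = (Z⁻, Z⁺)`. -/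
def circuitTriangulation (P N : Finset E) : Set (Finset E) :=
  {S | S ⊆ P ∪ N ∧ ¬ P ⊆ S}

open Classical in
/-- The link of `S` in `K`, the empty simplex included. -/
def simplexLink (K : Geometry.SimplicialComplex ℝ E) (S : Finset E) : Set (Finset E) :=
  {R | Disjoint R S ∧ R ∪ S ∈ allSimplices K}

open Classical in
/-- The join of two families of simplices. -/
def simplexJoin (X Y : Set (Finset E)) : Set (Finset E) :=
  {U | ∃ S ∈ X, ∃ R ∈ Y, U = S ∪ R}

/-- `K'` is obtained from `K` by a geometric bistellar flip supported on a circuit `(P, N)` of `A`: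
`T₊` is a subcomplex of `K`, all its maximal simplices have the same link `L` in `K`, and `K'`
arises from `K` by replacing `T₊ * L` by `T₋ * L`. -/
def IsFlip (A : Set E) (K K' : Geometry.SimplicialComplex ℝ E) : Prop :=
  ∃ P N : Finset E, IsCircuit A P N ∧
    circuitTriangulation P N ⊆ allSimplices K ∧
    ∃ L : Set (Finset E),
      (∀ S, Maximal (· ∈ circuitTriangulation P N) S → simplexLink K S = L) ∧
      allSimplices K' =
        (allSimplices K \ simplexJoin (circuitTriangulation P N) L) ∪
          simplexJoin (circuitTriangulation N P) L

/-- The graph of triangulations of `A`: two distinct triangulations are adjacent when one is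
obtained from the other by a flip. -/
def triangulationGraph (A : Set E) : SimpleGraph (Triangulation A) :=
  SimpleGraph.fromRel fun T T' => IsFlip A T.1 T'.1

end Triangulations

/-- The vertices of the regular 24-cell: the 8 points `±2 eᵢ` and the 16 points
`(±1, ±1, ±1, ±1)`. -/
def cell24 : Set (Fin 4 → ℝ) :=
  {v | ∃ i, v = Pi.single i 2 ∨ v = Pi.single i (-2)} ∪ {v | ∀ i, v i = 1 ∨ v i = -1}

/-- `A₅₀ = (A ∪ {O}) × {0, 1}` in `ℝ⁴ × ℝ = ℝ⁵`, where `A` is the vertex set of the 24-cell. -/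
def pointsA50 : Set ((Fin 4 → ℝ) × ℝ) :=
  (cell24 ∪ {0}) ×ˢ {0, 1}

/-- `A₅₀` with the points `(O, 0)` and `(O, 1)` moved to `(O, α)` and `(O, β)`. -/
def movedA50 (α β : ℝ) : Set ((Fin 4 → ℝ) × ℝ) :=
  (pointsA50 \ {(0, 0), (0, 1)}) ∪ {(0, α), (0, β)}

/-!
The squares `e × I` over the edges `e` of the 24-cell (`I = [0, 1]`) are faces of the configuration,
so every triangulation contains one diagonal of each of them and thereby orients the edges of the
24-cell: `xy` is directed from `x` to `y` if the diagonal from `(x, 0)` to `(y, 1)` is used.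

*Rigid orientations.* If the orientation is given by a symplectic form, then every edge `xy` is the
long edge of a directed triangle `x → z → y` (`DirEdge.exists_between`), and the prism over that
triangle is a face of the configuration. The only triangulation of this prism that contains the
three diagonals has a tetrahedron with vertices `(x, 0)`, `(y, 0)`, `(z, 0)`, `(y, 1)`
(`IsTriangulation.mem_of_directed_triangle`). A flip that reverses `xy` would be a flip on the
circuit of the square over `xy` with `(z, 0)` in its link; then it would need the edge from `(z, 0)`
to `(x, 1)`, which is the wrong diagonal of the square over `xz`. Hence no flip changes the
orientation (`Induces.of_reachable`). The forms `± dx_a ∧ dx_b ± dx_c ∧ dx_d` give 12 such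
orientations, which are pairwise distinct and distinct from a thirteenth one, given by a generic
linear functional (`exists_directed_of_ne`).

*Triangulations with a given orientation.* For all thirteen orientations every octahedral facet `F`
has a vertex that is a source of `F` and whose antipode is a sink of `F` (`exists_source`). The
prism `F × I` is the union of the join of the upper copy of the sink and `F × {0}`, the join of the
lower copy of the source and `F × {1}`, and the join of the segment from the lower source to the
upper sink and the squares over the equator of `F` (`prism_unique`, `prism_exists`). Each of the two
copies of `F` is triangulated by the choice of one of its three diagonals; together with the two
apices over the origin one obtains a triangulation of the whole configuration
(`uniqueWeights_cells`, `exists_cell_of_mem_convexHull`). The 48 choices are independent, which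
gives `3 ^ 48` triangulations, and changing one choice is a flip on the circuit formed by two
diagonals of an octahedron (`isFlip_update`). So for each orientation all of these triangulations
belong to one component, and the components of distinct orientations are distinct.
-/

/-! ### The 24-cell, its facets and the orientations of its edges -/

/-- The vertices of the 24-cell, with integer coordinates, in a fixed order. -/
def vertexZ : Fin 24 → Fin 4 → ℤ :=
  ![![2, 0, 0, 0], ![-2, 0, 0, 0], ![0, 2, 0, 0], ![0, -2, 0, 0], ![0, 0, 2, 0], ![0, 0, -2, 0],
    ![0, 0, 0, 2], ![0, 0, 0, -2], ![1, 1, 1, 1], ![-1, 1, 1, 1], ![1, -1, 1, 1], ![-1, -1, 1, 1],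
    ![1, 1, -1, 1], ![-1, 1, -1, 1], ![1, -1, -1, 1], ![-1, -1, -1, 1], ![1, 1, 1, -1], ![-1, 1, 1, -1],
    ![1, -1, 1, -1], ![-1, -1, 1, -1], ![1, 1, -1, -1], ![-1, 1, -1, -1], ![1, -1, -1, -1], ![-1, -1, -1, -1]]

/-- The centres of the 24 octahedral facets of the 24-cell: the facet with centre `c` lies in the
hyperplane `⟨·, c⟩ = 2`. -/
def centerZ : Fin 24 → Fin 4 → ℤ :=
  ![![1, 1, 0, 0], ![1, -1, 0, 0], ![-1, 1, 0, 0], ![-1, -1, 0, 0], ![1, 0, 1, 0], ![1, 0, -1, 0],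
    ![-1, 0, 1, 0], ![-1, 0, -1, 0], ![1, 0, 0, 1], ![1, 0, 0, -1], ![-1, 0, 0, 1], ![-1, 0, 0, -1],
    ![0, 1, 1, 0], ![0, 1, -1, 0], ![0, -1, 1, 0], ![0, -1, -1, 0], ![0, 1, 0, 1], ![0, 1, 0, -1],
    ![0, -1, 0, 1], ![0, -1, 0, -1], ![0, 0, 1, 1], ![0, 0, 1, -1], ![0, 0, -1, 1], ![0, 0, -1, -1]]

/-- The six vertices of each facet, as three pairs of antipodes (pairs with midpoint
`centerZ F`). -/
def antipodes : Fin 24 → Fin 3 → Fin 24 × Fin 24 :=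
  ![![(0, 2), (8, 20), (12, 16)], ![(0, 3), (10, 22), (14, 18)], ![(1, 2), (9, 21), (13, 17)],
    ![(1, 3), (11, 23), (15, 19)], ![(0, 4), (8, 18), (10, 16)], ![(0, 5), (12, 22), (14, 20)],
    ![(1, 4), (9, 19), (11, 17)], ![(1, 5), (13, 23), (15, 21)], ![(0, 6), (8, 14), (10, 12)],
    ![(0, 7), (16, 22), (18, 20)], ![(1, 6), (9, 15), (11, 13)], ![(1, 7), (17, 23), (19, 21)],
    ![(2, 4), (8, 17), (9, 16)], ![(2, 5), (12, 21), (13, 20)], ![(3, 4), (10, 19), (11, 18)],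
    ![(3, 5), (14, 23), (15, 22)], ![(2, 6), (8, 13), (9, 12)], ![(2, 7), (16, 21), (17, 20)],
    ![(3, 6), (10, 15), (11, 14)], ![(3, 7), (18, 23), (19, 22)], ![(4, 6), (8, 11), (9, 10)],
    ![(4, 7), (16, 19), (17, 18)], ![(5, 6), (12, 15), (13, 14)], ![(5, 7), (20, 23), (21, 22)]]

/-- The vertices of the facet `F`, indexed by an axis and an end of it. -/
def facetVertex (F : Fin 24) (i : Fin 3) (b : Bool) : Fin 24 :=
  if b then (antipodes F i).2 else (antipodes F i).1

/-- The vertices of the facet `F` after a change of indices that gives the index `(0, false)` to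
the vertex `s`; the indices `(i, false)` and `(i, true)` still belong to antipodes. -/
def corner (F : Fin 24) (s : Fin 3 × Bool) (i : Fin 3) (b : Bool) : Fin 24 :=
  facetVertex F (i + s.1) (xor b s.2)

/-- The integer inner product of two vectors. -/
def dotZ (u v : Fin 4 → ℤ) : ℤ := u 0 * v 0 + u 1 * v 1 + u 2 * v 2 + u 3 * v 3

/-- Two vertices of the 24-cell span an edge iff their inner product is `2`. -/
def CellAdj (x y : Fin 24) : Prop := dotZ (vertexZ x) (vertexZ y) = 2

instance : DecidableRel CellAdj := fun _ _ => inferInstanceAs (Decidable (_ = _))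

/-- Being a vertex of a facet. -/
def InFacet (x F : Fin 24) : Prop := dotZ (vertexZ x) (centerZ F) = 2

instance : DecidableRel InFacet := fun _ _ => inferInstanceAs (Decidable (_ = _))

/-- The three perfect matchings `ab|cd` of the coordinates, listed as `a, b, c, d`. -/
def matching : Fin 3 → Fin 4 → Fin 4 := ![![0, 1, 2, 3], ![0, 2, 1, 3], ![0, 3, 1, 2]]

/-- The antisymmetric functions that orient the edges of the 24-cell: for `some (m, ε, ε')` the
symplectic form `± dx_a ∧ dx_b ± dx_c ∧ dx_d`, where `ab|cd` is the perfect matching `m`; for `none`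
the difference of the values of a linear functional that is not constant on any edge. -/
def orientForm : Option (Fin 3 × Bool × Bool) → (Fin 4 → ℤ) → (Fin 4 → ℤ) → ℤ
  | some (m, ε, ε'), u, v =>
    (if ε then 1 else -1) *
        (u (matching m 0) * v (matching m 1) - u (matching m 1) * v (matching m 0)) +
      (if ε' then 1 else -1) *
        (u (matching m 2) * v (matching m 3) - u (matching m 3) * v (matching m 2))
  | none, u, v => dotZ ![8, 4, 2, 1] v - dotZ ![8, 4, 2, 1] u

/-- The edge `xy` of the 24-cell is directed from `x` to `y` in the orientation `o`. -/
def DirEdge (o : Option (Fin 3 × Bool × Bool)) (x y : Fin 24) : Prop :=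
  CellAdj x y ∧ 0 < orientForm o (vertexZ x) (vertexZ y)

instance (o : Option (Fin 3 × Bool × Bool)) : DecidableRel (DirEdge o) :=
  fun _ _ => inferInstanceAs (Decidable (_ ∧ _))

theorem dotZ_vertexZ_self : ∀ x, dotZ (vertexZ x) (vertexZ x) = 4 := by decide +kernel

theorem dotZ_vertexZ_le : ∀ x y, x ≠ y → dotZ (vertexZ x) (vertexZ y) ≤ 2 := by decide +kernel

theorem dotZ_vertexZ_centerZ_le : ∀ x F, dotZ (vertexZ x) (centerZ F) ≤ 2 := by decide +kernel

theorem inFacet_facetVertex : ∀ F i b, InFacet (facetVertex F i b) F := by decide +kernel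

theorem InFacet.exists_facetVertex : ∀ {x F}, InFacet x F → ∃ i b, x = facetVertex F i b := by
  decide +kernel

theorem vertexZ_facetVertex_add : ∀ F i k, vertexZ (facetVertex F i false) k +
    vertexZ (facetVertex F i true) k = 2 * centerZ F k := by decide +kernel

theorem dotZ_facetVertex_of_ne : ∀ F i j, i ≠ j → ∀ b b',
    dotZ (vertexZ (facetVertex F i b)) (vertexZ (facetVertex F j b')) = 2 := by decide +kernel

theorem dotZ_facetVertex_antipode : ∀ F i b,
    dotZ (vertexZ (facetVertex F i b)) (vertexZ (facetVertex F i !b)) = 0 := by decide +kernel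

theorem eq_of_inFacet_facetVertex : ∀ F i F', InFacet (facetVertex F i false) F' →
    InFacet (facetVertex F i true) F' → F' = F := by decide +kernel

theorem facetVertex_resolution : ∀ F k k',
    4 * centerZ F k * centerZ F k' + ∑ i,
      (vertexZ (facetVertex F i true) k - vertexZ (facetVertex F i false) k) *
        (vertexZ (facetVertex F i true) k' - vertexZ (facetVertex F i false) k') =
      if k = k' then 8 else 0 := by
  simp only [Fin.sum_univ_three]
  decide +kernel

/-- The functionals that bound the cone over the facet `F` are differences of centres of facets. -/
theorem exists_centerZ_eq : ∀ F b₀ b₁ b₂, ∃ F', ∀ k,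
    4 * centerZ F' k = 2 * centerZ F k +
      (vertexZ (facetVertex F 0 b₀) k - vertexZ (facetVertex F 0 !b₀) k) +
      (vertexZ (facetVertex F 1 b₁) k - vertexZ (facetVertex F 1 !b₁) k) +
      (vertexZ (facetVertex F 2 b₂) k - vertexZ (facetVertex F 2 !b₂) k) := by
  decide +kernel

theorem inFacet_corner (F : Fin 24) (s : Fin 3 × Bool) (i : Fin 3) (b : Bool) :
    InFacet (corner F s i b) F :=
  inFacet_facetVertex _ _ _

theorem InFacet.exists_corner {x F : Fin 24} (h : InFacet x F) (s : Fin 3 × Bool) :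
    ∃ i b, x = corner F s i b := by
  obtain ⟨i, b, rfl⟩ := h.exists_facetVertex
  exact ⟨i - s.1, xor b s.2, by simp [corner]⟩

theorem dotZ_corner_of_ne (F : Fin 24) (s : Fin 3 × Bool) {i j : Fin 3} (h : i ≠ j) (b b' : Bool) :
    dotZ (vertexZ (corner F s i b)) (vertexZ (corner F s j b')) = 2 :=
  dotZ_facetVertex_of_ne _ _ _ (by simpa using h) _ _

theorem dotZ_corner_antipode (F : Fin 24) (s : Fin 3 × Bool) (i : Fin 3) (b : Bool) :
    dotZ (vertexZ (corner F s i b)) (vertexZ (corner F s i !b)) = 0 := by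
  simpa [corner] using dotZ_facetVertex_antipode F (i + s.1) (xor b s.2)

theorem corner_injective (F : Fin 24) (s : Fin 3 × Bool) {i i' : Fin 3} {b b' : Bool}
    (h : corner F s i b = corner F s i' b') : i = i' ∧ b = b' := by
  have h4 := dotZ_vertexZ_self (corner F s i b)
  by_cases hi : i = i'
  · subst hi
    refine ⟨rfl, ?_⟩
    by_contra hb
    have h0 := dotZ_corner_antipode F s i b
    rw [show (!b) = b' by cases b <;> cases b' <;> simp_all, ← h] at h0
    omega
  · have h2 := dotZ_corner_of_ne F s hi b b'
    rw [← h] at h2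
    omega

theorem vertexZ_corner_add (F : Fin 24) (s : Fin 3 × Bool) (i : Fin 3) (k : Fin 4) :
    vertexZ (corner F s i false) k + vertexZ (corner F s i true) k = 2 * centerZ F k := by
  have h := vertexZ_facetVertex_add F (i + s.1) k
  obtain ⟨s, b⟩ := s
  cases b <;> simp only [corner, Bool.xor_false, Bool.xor_true, Bool.not_true, Bool.not_false]
  · exact h
  · rw [add_comm]; exact h

/-- A facet is determined by a pair of antipodes. -/
theorem eq_of_inFacet_antipodes {F : Fin 24} {s : Fin 3 × Bool} {i : Fin 3} {F' : Fin 24}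
    (h : InFacet (corner F s i false) F') (h' : InFacet (corner F s i true) F') : F' = F := by
  obtain ⟨s, b⟩ := s
  cases b <;>
    simp only [corner, Bool.xor_false, Bool.xor_true, Bool.not_true, Bool.not_false] at h h'
  · exact eq_of_inFacet_facetVertex _ _ _ h h'
  · exact eq_of_inFacet_facetVertex _ _ _ h' h

/-- The centre and the axes of a facet are an orthogonal basis of the space. -/
theorem corner_resolution (F : Fin 24) (s : Fin 3 × Bool) (k k' : Fin 4) :
    4 * centerZ F k * centerZ F k' + ∑ i,
      (vertexZ (corner F s i true) k - vertexZ (corner F s i false) k) *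
        (vertexZ (corner F s i true) k' - vertexZ (corner F s i false) k') =
      if k = k' then 8 else 0 := by
  rw [← facetVertex_resolution, ← Equiv.sum_comp (Equiv.addRight s.1) (fun i =>
    (vertexZ (facetVertex F i true) k - vertexZ (facetVertex F i false) k) *
      (vertexZ (facetVertex F i true) k' - vertexZ (facetVertex F i false) k'))]
  obtain ⟨s, b⟩ := s
  congr 1
  refine Finset.sum_congr rfl fun i _ => ?_
  cases b <;> simp only [corner, Bool.xor_false, Bool.xor_true, Bool.not_true, Bool.not_false,
    Equiv.coe_addRight]
  ring

theorem CellAdj.directed_or : ∀ {x y}, CellAdj x y → ∀ o, DirEdge o x y ∨ DirEdge o y x := by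
  decide +kernel

theorem DirEdge.not_directed : ∀ {o x y}, DirEdge o x y → ¬ DirEdge o y x := by decide +kernel

/-- In every facet some vertex is a source and its antipode is a sink. -/
theorem exists_source : ∀ o F, ∃ s, ∀ i b, i ≠ 0 →
    DirEdge o (corner F s 0 false) (corner F s i b) ∧
      DirEdge o (corner F s i b) (corner F s 0 true) := by decide +kernel

/-- In a symplectic orientation every edge is the long edge of a directed triangle. With the complex
structure `J` such that `⟨J u, v⟩` is the symplectic form, the third vertex is `J (x - y)`. -/
theorem DirEdge.exists_between : ∀ {m x y}, DirEdge (some m) x y →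
    ∃ z, DirEdge (some m) x z ∧ DirEdge (some m) z y := by decide +kernel

theorem exists_directed_of_ne : ∀ o o', o ≠ o' → ∃ x y, DirEdge o x y ∧ DirEdge o' y x := by
  decide +kernel

theorem exists_vertexZ_eq_single : ∀ i, (∃ x, vertexZ x = Pi.single i 2) ∧
    ∃ x, vertexZ x = Pi.single i (-2) := by decide +kernel

theorem exists_vertexZ_eq_sign : ∀ a b c d : Bool, ∃ x, vertexZ x =
    ![if a then 1 else -1, if b then 1 else -1, if c then 1 else -1, if d then 1 else -1] := by
  decide +kernel

theorem vertexZ_mem : ∀ x, (∃ i, vertexZ x = Pi.single i 2 ∨ vertexZ x = Pi.single i (-2)) ∨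
    ∀ i, vertexZ x i = 1 ∨ vertexZ x i = -1 := by decide +kernel

/-! ### Simplicial complexes from unique convex combinations -/

section Maps

variable {ι E : Type*}

open Classical in
theorem circuitTriangulation_map [DecidableEq ι] (pos : ι ↪ E) (P N : Finset ι) :
    circuitTriangulation (P.map pos) (N.map pos) =
      Finset.map pos '' {S | S ⊆ P ∪ N ∧ ¬ P ⊆ S} := by
  ext S
  simp only [circuitTriangulation, ← Finset.map_union, Set.mem_ofPred_eq, Set.mem_image]
  constructor
  · rintro ⟨h, h'⟩
    obtain ⟨S, hS, rfl⟩ := Finset.subset_map_iff.1 h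
    exact ⟨S, ⟨hS, by simpa using h'⟩, rfl⟩
  · rintro ⟨S, ⟨hS, h'⟩, rfl⟩
    exact ⟨by simpa using hS, by simpa using h'⟩

open Classical in
theorem simplexJoin_map [DecidableEq ι] (pos : ι ↪ E) (X Y : Set (Finset ι)) :
    simplexJoin (Finset.map pos '' X) (Finset.map pos '' Y) =
      Finset.map pos '' {U | ∃ S ∈ X, ∃ R ∈ Y, U = S ∪ R} := by
  ext U
  simp only [simplexJoin, Set.mem_ofPred_eq, Set.mem_image]
  constructor
  · rintro ⟨_, ⟨S, hS, rfl⟩, _, ⟨R, hR, rfl⟩, rfl⟩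
    exact ⟨_, ⟨S, hS, R, hR, rfl⟩, by rw [Finset.map_union]⟩
  · rintro ⟨_, ⟨S, hS, R, hR, rfl⟩, rfl⟩
    exact ⟨_, ⟨S, hS, rfl⟩, _, ⟨R, hR, rfl⟩, by rw [Finset.map_union]⟩

end Maps

section Realization

variable {ι E : Type*} [Fintype ι] [AddCommGroup E] [Module ℝ E]

/-- Every point is in at most one way a convex combination, with coefficients supported on a member
of `K`, of the points `pos i`. -/
def UniqueWeights (pos : ι → E) (K : Set (Finset ι)) : Prop :=
  ∀ σ ∈ K, ∀ τ ∈ K, ∀ w w' : ι → ℝ, (∀ i, 0 ≤ w i) → (∀ i, 0 ≤ w' i) →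
    (∀ i, w i ≠ 0 → i ∈ σ) → (∀ i, w' i ≠ 0 → i ∈ τ) → ∑ i, w i = 1 → ∑ i, w' i = 1 →
    ∑ i, w i • pos i = ∑ i, w' i • pos i → w = w'

theorem sum_smul_mem_convexHull {κ : Type*} [Fintype κ] {S : Set E} (f : κ → E) (u : κ → ℝ)
    (h0 : ∀ k, 0 ≤ u k) (h1 : ∑ k, u k = 1) (hS : ∀ k, u k ≠ 0 → f k ∈ S) :
    ∑ k, u k • f k ∈ convexHull ℝ S := by
  classical
  have e1 : ∑ k with u k ≠ 0, u k = 1 := by rw [Finset.sum_filter_ne_zero, h1]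
  have e2 : ∑ k with u k ≠ 0, u k • f k = ∑ k, u k • f k := by
    refine Finset.sum_subset (Finset.filter_subset _ _) fun k _ hk => ?_
    have : u k = 0 := by simpa using hk
    simp [this]
  rw [← e2]
  exact (convex_convexHull ℝ S).sum_mem (fun k _ => h0 k) e1
    fun k hk => subset_convexHull ℝ S (hS k (Finset.mem_filter.1 hk).2)

theorem mem_convexHull_map_iff {pos : ι ↪ E} {σ : Finset ι} {x : E} :
    x ∈ convexHull ℝ (σ.map pos : Set E) ↔ ∃ w : ι → ℝ, (∀ i, 0 ≤ w i) ∧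
      (∀ i, w i ≠ 0 → i ∈ σ) ∧ ∑ i, w i = 1 ∧ ∑ i, w i • pos i = x := by
  classical
  constructor
  · intro h
    obtain ⟨w, h0, h1, rfl⟩ := Finset.mem_convexHull'.1 h
    refine ⟨fun i => if i ∈ σ then w (pos i) else 0, fun i => ?_, fun i hi => ?_, ?_, ?_⟩
    · dsimp only
      split_ifs with hi
      · exact h0 _ (Finset.mem_map_of_mem _ hi)
      · exact le_rfl
    · by_contra hi'
      simp [hi'] at hi
    · simpa [Finset.sum_ite_mem] using h1
    · simp [ite_smul, Finset.sum_ite_mem]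
  · rintro ⟨w, h0, hσ, h1, rfl⟩
    exact sum_smul_mem_convexHull pos w h0 h1 fun i hi => by simpa using hσ i hi

theorem UniqueWeights.affineIndependent {pos : ι → E} {K : Set (Finset ι)}
    (hU : UniqueWeights pos K) {σ : Finset ι} (hσ : σ ∈ K) :
    AffineIndependent ℝ fun i : σ => pos i := by
  rw [affineIndependent_iff_of_fintype]
  intro w hw hw' i
  rw [Finset.univ.weightedVSub_eq_linear_combination hw] at hw'
  set c : ι → ℝ := Function.extend Subtype.val w 0 with hc
  have hcσ : ∀ i : σ, c i = w i := fun i => Subtype.val_injective.extend_apply w 0 i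
  have hc0 : ∀ i, i ∉ Set.range (Subtype.val : σ → ι) → c i = 0 := fun i hi => by
    rw [hc, Function.extend_apply' _ _ _ (by simpa using hi)]; rfl
  have hs : ∑ i, c i = 0 := by
    rw [← hw]
    exact (Fintype.sum_of_injective _ Subtype.val_injective _ _ hc0 fun i => (hcσ i).symm).symm
  have hs' : ∑ i, c i • pos i = 0 := by
    rw [← hw']
    exact (Fintype.sum_of_injective _ Subtype.val_injective _ _ (fun i hi => by simp [hc0 i hi])
      fun i => by simp [hcσ i]).symm
  -- The positive and the negative part of an affine dependence represent the same point.
  have hpn : ∀ i, (c i)⁺ - (c i)⁻ = c i := fun i => posPart_sub_negPart _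
  have hS : ∑ i, (c i)⁺ = ∑ i, (c i)⁻ := by
    rw [← sub_eq_zero, ← Finset.sum_sub_distrib]; simpa [hpn] using hs
  have hP : ∑ i, (c i)⁺ • pos i = ∑ i, (c i)⁻ • pos i := by
    rw [← sub_eq_zero, ← Finset.sum_sub_distrib]; simpa [← sub_smul, hpn] using hs'
  have hsupp : ∀ i, c i ≠ 0 → i ∈ σ := fun i hi => by
    by_contra h
    exact hi (hc0 i (by simpa using h))
  rcases eq_or_ne (∑ i, (c i)⁺) 0 with h0 | h0
  · have hp := (Finset.sum_eq_zero_iff_of_nonneg fun i _ => posPart_nonneg (c i)).1 h0 i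
      (Finset.mem_univ _)
    have hn := (Finset.sum_eq_zero_iff_of_nonneg fun i _ => negPart_nonneg (c i)).1 (hS ▸ h0) i
      (Finset.mem_univ _)
    rw [← hcσ, ← hpn, hp, hn, sub_zero]
  · set S := ∑ i, (c i)⁺ with hSdef
    have hSpos : 0 ≤ S⁻¹ := inv_nonneg.2 (Finset.sum_nonneg fun i _ => posPart_nonneg (c i))
    have key := hU σ hσ σ hσ (fun i => S⁻¹ * (c i)⁺) (fun i => S⁻¹ * (c i)⁻)
      (fun i => mul_nonneg hSpos (posPart_nonneg _)) (fun i => mul_nonneg hSpos (negPart_nonneg _))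
      (fun i hi => hsupp i fun h => hi (by simp [h])) (fun i hi => hsupp i fun h => hi (by simp [h]))
      (by rw [← Finset.mul_sum, ← hSdef, inv_mul_cancel₀ h0])
      (by rw [← Finset.mul_sum, ← hS, inv_mul_cancel₀ h0])
      (by simp only [mul_smul, ← Finset.smul_sum, hP])
    have h1 : (c i)⁺ = (c i)⁻ := by
      simpa [h0] using congrFun key i
    rw [← hcσ, ← hpn, h1, sub_self]

theorem UniqueWeights.affineIndependent_map {pos : ι ↪ E} {K : Set (Finset ι)}
    (hU : UniqueWeights pos K) {σ : Finset ι} (hσ : σ ∈ K) :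
    AffineIndependent ℝ ((↑) : σ.map pos → E) := by
  have h := (hU.affineIndependent hσ).range
  have hr : Set.range (fun i : σ => pos i) = (σ.map pos : Set E) := by
    ext x; simp
  rw [hr] at h
  exact h

open Classical in
/-- The geometric simplicial complex on the points `pos i` that is described by the family `K` of
subsets of the index set. -/
def realization (pos : ι ↪ E) (K : Set (Finset ι)) (hK : IsLowerSet K)
    (hU : UniqueWeights pos K) : Geometry.SimplicialComplex ℝ E :=
  Geometry.SimplicialComplex.ofErase (Finset.map pos '' K)
    (by
      rintro _ ⟨σ, hσ, rfl⟩
      exact hU.affineIndependent_map hσ)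
    (by
      rintro _ τ hτ ⟨σ, hσ, rfl⟩
      obtain ⟨τ, hτσ, rfl⟩ := Finset.subset_map_iff.1 hτ
      exact ⟨τ, hK hτσ hσ, rfl⟩)
    (by
      rintro _ ⟨σ, hσ, rfl⟩ _ ⟨τ, hτ, rfl⟩ x ⟨hx, hx'⟩
      obtain ⟨w, h0, hwσ, h1, rfl⟩ := mem_convexHull_map_iff.1 hx
      obtain ⟨w', h0', hwτ, h1', hw⟩ := mem_convexHull_map_iff.1 hx'
      obtain rfl := hU σ hσ τ hτ w w' h0 h0' hwσ hwτ h1 h1' hw.symm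
      rw [← Finset.coe_inter, ← Finset.map_inter]
      exact mem_convexHull_map_iff.2
        ⟨w, h0, fun i hi => Finset.mem_inter.2 ⟨hwσ i hi, hwτ i hi⟩, h1, rfl⟩)

variable {pos : ι ↪ E} {K K' : Set (Finset ι)} {hK : IsLowerSet K} {hU : UniqueWeights pos K}
  {hK' : IsLowerSet K'} {hU' : UniqueWeights pos K'}

theorem mem_realization_faces {σ : Finset E} :
    σ ∈ (realization pos K hK hU).faces ↔ σ.Nonempty ∧ ∃ s ∈ K, s.map pos = σ := by
  simp only [realization, Geometry.SimplicialComplex.ofErase, Set.mem_sdiff, Set.mem_image,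
    Set.mem_singleton_iff, Finset.nonempty_iff_ne_empty, ne_eq]
  exact and_comm

theorem map_mem_realization_faces {σ : Finset ι} :
    σ.map pos ∈ (realization pos K hK hU).faces ↔ σ.Nonempty ∧ σ ∈ K := by
  rw [mem_realization_faces]
  simp

theorem mem_realization_space {x : E} :
    x ∈ (realization pos K hK hU).space ↔ ∃ σ ∈ K, x ∈ convexHull ℝ (σ.map pos : Set E) := by
  rw [Geometry.SimplicialComplex.mem_space_iff]
  constructor
  · rintro ⟨_, hσ, hx⟩
    obtain ⟨-, s, hs, rfl⟩ := mem_realization_faces.1 hσ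
    exact ⟨s, hs, hx⟩
  · rintro ⟨σ, hσ, hx⟩
    refine ⟨_, map_mem_realization_faces.2 ⟨?_, hσ⟩, hx⟩
    rw [Finset.nonempty_iff_ne_empty]
    rintro rfl
    simp at hx

theorem allSimplices_realization (h : ∅ ∈ K) :
    allSimplices (realization pos K hK hU) = Finset.map pos '' K := by
  ext σ
  simp only [allSimplices, Set.mem_insert_iff, mem_realization_faces, Set.mem_image]
  constructor
  · rintro (rfl | ⟨-, h⟩)
    · exact ⟨∅, h, rfl⟩
    · exact h
  · intro h
    rcases σ.eq_empty_or_nonempty with rfl | hσ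
    · exact .inl rfl
    · exact .inr ⟨hσ, h⟩

theorem isTriangulation_realization {A : Set E} (hA : Set.range pos = A)
    (hc : ∀ x ∈ convexHull ℝ A, ∃ σ ∈ K, x ∈ convexHull ℝ (σ.map pos : Set E)) :
    IsTriangulation A (realization pos K hK hU) := by
  subst hA
  constructor
  · intro x hx
    obtain ⟨-, s, -, hs⟩ := mem_realization_faces.1 (Geometry.SimplicialComplex.mem_vertices.1 hx)
    have : x ∈ s.map pos := by simp [hs]
    obtain ⟨i, -, rfl⟩ := Finset.mem_map.1 this
    exact ⟨i, rfl⟩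
  · ext x
    rw [mem_realization_space]
    refine ⟨?_, hc x⟩
    rintro ⟨σ, -, hx⟩
    exact convexHull_mono (by simp) hx

/-! ### A combinatorial criterion for flips -/

theorem union_mem_of_link [DecidableEq ι] {K L : Set (Finset ι)} {P N Z : Finset ι}
    (hK : IsLowerSet K) (hPN : Disjoint P N) (hPZ : P ⊆ Z) (hNZ : N ⊆ Z)
    (hLd : ∀ R ∈ L, Disjoint R Z) (hN : ∀ σ, N ⊆ σ → (σ ∈ K ↔ ¬ P ⊆ σ ∧ σ \ Z ∈ L))
    {S R : Finset ι} (hS : S ⊆ Z) (hPS : ¬ P ⊆ S) (hR : R ∈ L) : S ∪ R ∈ K := by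
  obtain ⟨p, hp, hpS⟩ := Finset.not_subset.1 hPS
  have hd := hLd R hR
  have hsub : S ∪ R ⊆ N ∪ (S ∪ R) := Finset.subset_union_right
  refine hK hsub ((hN _ Finset.subset_union_left).2 ⟨fun h => ?_, ?_⟩)
  · have h1 := h hp
    simp only [Finset.mem_union, hpS, false_or] at h1
    exact h1.elim (Finset.disjoint_left.1 hPN hp) fun h => Finset.disjoint_left.1 hd h (hPZ hp)
  · rwa [← Finset.union_assoc, Finset.union_sdiff_distrib,
      Finset.sdiff_eq_empty_iff_subset.2 (Finset.union_subset hNZ hS), Finset.empty_union,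
      hd.sdiff_eq_left]

open Classical in
/-- Two complexes differ by a flip on the circuit `(P, N)` if the simplices of the first one that
contain `N`, and those of the second one that contain `P`, are described by a common link `L`, and
the complexes agree on all other simplices. -/
theorem isFlip_realization [DecidableEq ι] {A : Set E} (hA : ∀ i, pos i ∈ A) {P N : Finset ι}
    (hPN : Disjoint P N)
    (hconv : (convexHull ℝ (P.map pos : Set E) ∩ convexHull ℝ (N.map pos : Set E)).Nonempty)
    {L : Set (Finset ι)} (hL : ∅ ∈ L) (hLd : ∀ R ∈ L, Disjoint R (P ∪ N))
    (hN : ∀ σ, N ⊆ σ → (σ ∈ K ↔ ¬ P ⊆ σ ∧ σ \ (P ∪ N) ∈ L))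
    (hP : ∀ σ, P ⊆ σ → (σ ∈ K' ↔ ¬ N ⊆ σ ∧ σ \ (P ∪ N) ∈ L))
    (hPK : P ∉ K) (hNK' : N ∉ K') (hKK' : ∀ σ, ¬ P ⊆ σ → ¬ N ⊆ σ → (σ ∈ K ↔ σ ∈ K')) :
    IsFlip A (realization pos K hK hU) (realization pos K' hK' hU') := by
  obtain ⟨x, hxP, hxN⟩ := hconv
  have hPne : P.Nonempty := by
    rw [Finset.nonempty_iff_ne_empty]; rintro rfl; simp at hxP
  have hNne : N.Nonempty := by
    rw [Finset.nonempty_iff_ne_empty]; rintro rfl; simp at hxN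
  have hPZ : P ⊆ P ∪ N := Finset.subset_union_left
  have hNZ : N ⊆ P ∪ N := Finset.subset_union_right
  have hjoin : ∀ S R, S ⊆ P ∪ N → ¬ P ⊆ S → R ∈ L → S ∪ R ∈ K :=
    fun S R => union_mem_of_link hK hPN hPZ hNZ hLd hN
  have hjoin' : ∀ S R, S ⊆ P ∪ N → ¬ N ⊆ S → R ∈ L → S ∪ R ∈ K' :=
    fun S R => union_mem_of_link hK' hPN.symm hNZ hPZ hLd hP
  have hTK : ∀ S, S ⊆ P ∪ N → ¬ P ⊆ S → S ∈ K := fun S h h' => by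
    simpa using hjoin S ∅ h h' hL
  have hTK' : ∀ S, S ⊆ P ∪ N → ¬ N ⊆ S → S ∈ K' := fun S h h' => by
    simpa using hjoin' S ∅ h h' hL
  have h0 : ∅ ∈ K := hTK ∅ (by simp) (by simpa using hPne.ne_empty)
  have h0' : ∅ ∈ K' := hTK' ∅ (by simp) (by simpa using hNne.ne_empty)
  refine ⟨P.map pos, N.map pos, ⟨?_, ?_, ?_, ?_, ⟨x, hxP, hxN⟩⟩, ?_, Finset.map pos '' L, ?_, ?_⟩
  · simpa using hPN
  · rw [← Finset.map_union]
    intro y hy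
    obtain ⟨i, -, rfl⟩ := Finset.mem_map.1 (Finset.mem_coe.1 hy)
    exact hA i
  · intro h
    have := h.convexHull_inter (t₁ := P.map pos) (t₂ := N.map pos) (by simp) (by simp)
    rw [← Finset.coe_inter, Finset.disjoint_iff_inter_eq_empty.1 (by simpa using hPN)] at this
    have hx : x ∈ convexHull ℝ ((∅ : Finset E) : Set E) := this ▸ ⟨hxP, hxN⟩
    simp at hx
  · intro W hW
    rw [← Finset.map_union] at hW
    obtain ⟨W, hW', rfl⟩ := Finset.subset_map_iff.1 hW.1
    by_cases hPW : P ⊆ W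
    · have hNW : ¬ N ⊆ W := fun h => hW.2 (by simpa using Finset.union_subset hPW h)
      exact hU'.affineIndependent_map (hTK' W hW' hNW)
    · exact hU.affineIndependent_map (hTK W hW' hPW)
  · rw [circuitTriangulation_map, allSimplices_realization h0]
    rintro _ ⟨S, ⟨hS, hS'⟩, rfl⟩
    exact ⟨S, hTK S hS hS', rfl⟩
  · rw [circuitTriangulation_map]
    rintro _ ⟨⟨S, ⟨hS, hS'⟩, rfl⟩, hmax⟩
    obtain ⟨p, hp, hpS⟩ := Finset.not_subset.1 hS'
    -- A maximal simplex misses exactly one element of `P`.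
    have hSe : S = (P ∪ N).erase p := by
      have hsub : S ⊆ (P ∪ N).erase p := fun i hi =>
        Finset.mem_erase.2 ⟨by rintro rfl; exact hpS hi, hS hi⟩
      refine hsub.antisymm ?_
      have := hmax ⟨_, ⟨Finset.erase_subset _ _, fun h => by simpa using h hp⟩, rfl⟩
        (Finset.map_subset_map.2 hsub)
      exact Finset.map_subset_map.1 this
    have hNS : N ⊆ S := fun i hi => by
      rw [hSe, Finset.mem_erase]
      exact ⟨by rintro rfl; exact Finset.disjoint_left.1 hPN hp hi, hNZ hi⟩
    ext R
    simp only [simplexLink, allSimplices_realization h0, Set.mem_ofPred_eq, Set.mem_image]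
    constructor
    · rintro ⟨hd, τ, hτ, hτR⟩
      obtain ⟨R, hR, rfl⟩ := Finset.subset_map_iff.1
        (show R ⊆ τ.map pos by rw [hτR]; exact Finset.subset_union_left)
      have hd' : Disjoint R S := by simpa using hd
      obtain rfl : τ = R ∪ S := by
        apply Finset.map_injective pos
        rw [hτR, Finset.map_union]
      have h3 := (hN _ (hNS.trans Finset.subset_union_right)).1 hτ
      have hpR : p ∉ R := fun h => h3.1 fun i hi => by
        by_cases hip : i = p
        · simp [hip, h]
        · simp [hSe, hip, hi]
      have hRZ : Disjoint R (P ∪ N) := by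
        rw [← Finset.insert_erase (hPZ hp), ← hSe, Finset.disjoint_insert_right]
        exact ⟨hpR, hd'⟩
      have h4 := h3.2
      rw [Finset.union_sdiff_distrib, hRZ.sdiff_eq_left, Finset.sdiff_eq_empty_iff_subset.2 hS,
        Finset.union_empty] at h4
      exact ⟨R, h4, rfl⟩
    · rintro ⟨R, hR, rfl⟩
      exact ⟨by simpa using (hLd R hR).mono_right hS, S ∪ R, hjoin S R hS hS' hR,
        by rw [Finset.map_union, Finset.union_comm]⟩
  · rw [circuitTriangulation_map, circuitTriangulation_map, simplexJoin_map, simplexJoin_map,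
      allSimplices_realization h0, allSimplices_realization h0',
      ← Set.image_sdiff (Finset.map_injective pos), ← Set.image_union]
    congr 1
    ext σ
    simp only [Set.mem_union, Set.mem_sdiff, Set.mem_ofPred_eq, not_exists, not_and]
    have hsplit : σ = (σ ∩ (P ∪ N)) ∪ (σ \ (P ∪ N)) := by
      ext i; simp only [Finset.mem_union, Finset.mem_inter, Finset.mem_sdiff]; tauto
    have hinter : ∀ {Q : Finset ι}, ¬ Q ⊆ σ → ¬ Q ⊆ σ ∩ (P ∪ N) :=
      fun h h' => h (h'.trans Finset.inter_subset_left)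
    constructor
    · intro hσ
      by_cases hPσ : P ⊆ σ
      · right
        obtain ⟨h1, h2⟩ := (hP σ hPσ).1 hσ
        exact ⟨σ ∩ (P ∪ N), ⟨by rw [Finset.union_comm N]; exact Finset.inter_subset_right,
          hinter h1⟩, _, h2, hsplit⟩
      · have hNσ : ¬ N ⊆ σ := fun h => hNK' (hK' h hσ)
        by_cases hj : ∃ S, (S ⊆ P ∪ N ∧ ¬ P ⊆ S) ∧ ∃ R, R ∈ L ∧ σ = S ∪ R
        · obtain ⟨S, ⟨hS, -⟩, R, hR, rfl⟩ := hj
          exact .inr ⟨S, ⟨by rwa [Finset.union_comm N],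
            fun h => hNσ (h.trans Finset.subset_union_left)⟩, R, hR, rfl⟩
        · exact .inl ⟨(hKK' σ hPσ hNσ).2 hσ, fun S hS R hR h => hj ⟨S, hS, R, hR, h⟩⟩
    · rintro (⟨hσ, hj⟩ | ⟨S, ⟨hS, hS'⟩, R, hR, rfl⟩)
      · have hPσ : ¬ P ⊆ σ := fun h => hPK (hK h hσ)
        by_cases hNσ : N ⊆ σ
        · exact absurd hsplit (hj _ ⟨Finset.inter_subset_right, hinter hPσ⟩ _ ((hN σ hNσ).1 hσ).2)
        · exact (hKK' σ hPσ hNσ).1 hσ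
      · exact hjoin' S R (by rwa [Finset.union_comm N] at hS) hS' hR

end Realization

/-! ### The point configuration -/

/-- Labels of the points of the configuration: `(some x, l)` is the vertex `x` of the 24-cell at
height `0` or `1`, and `(none, l)` is one of the two moved copies of the origin. -/
abbrev Label := Option (Fin 24) × Bool

/-- The vertices of the 24-cell as real vectors. -/
def vertexR (x : Fin 24) : Fin 4 → ℝ := fun k => vertexZ x k

/-- The centres of the facets as real vectors. -/
def centerR (F : Fin 24) : Fin 4 → ℝ := fun k => centerZ F k

/-- The point with a given label. -/
def location (α β : ℝ) : Label → (Fin 4 → ℝ) × ℝ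
  | (some x, l) => (vertexR x, if l then 1 else 0)
  | (none, l) => (0, if l then β else α)

theorem cast_dotZ (u v : Fin 4 → ℤ) :
    (fun k => (u k : ℝ)) ⬝ᵥ (fun k => (v k : ℝ)) = dotZ u v := by
  simp [dotProduct, Fin.sum_univ_four, dotZ]

theorem vertexR_dot_vertexR (x y : Fin 24) :
    vertexR x ⬝ᵥ vertexR y = dotZ (vertexZ x) (vertexZ y) := cast_dotZ _ _

theorem vertexR_dot_centerR (x F : Fin 24) :
    vertexR x ⬝ᵥ centerR F = dotZ (vertexZ x) (centerZ F) := cast_dotZ _ _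

theorem vertexR_dot_self (x : Fin 24) : vertexR x ⬝ᵥ vertexR x = 4 := by
  rw [vertexR_dot_vertexR, dotZ_vertexZ_self]; norm_num

theorem CellAdj.dot_eq {x y : Fin 24} (h : CellAdj x y) : vertexR x ⬝ᵥ vertexR y = 2 := by
  rw [vertexR_dot_vertexR, show dotZ _ _ = 2 from h]; norm_num

theorem vertexR_dot_le {x y : Fin 24} (h : x ≠ y) : vertexR x ⬝ᵥ vertexR y ≤ 2 := by
  rw [vertexR_dot_vertexR]; exact_mod_cast dotZ_vertexZ_le x y h

theorem CellAdj.symm {x y : Fin 24} (h : CellAdj x y) : CellAdj y x := by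
  unfold CellAdj dotZ at *
  linarith

theorem CellAdj.ne {x y : Fin 24} (h : CellAdj x y) : x ≠ y := by
  rintro rfl
  have h1 := dotZ_vertexZ_self x
  rw [show dotZ _ _ = 2 from h] at h1
  norm_num at h1

theorem vertexR_injective : Function.Injective vertexR := by
  intro x y h
  by_contra hne
  have h1 := vertexR_dot_le hne
  rw [← h, vertexR_dot_self] at h1
  norm_num at h1

theorem vertexR_ne_zero (x : Fin 24) : vertexR x ≠ 0 := by
  intro h
  have := vertexR_dot_self x
  simp [h] at this

theorem location_injective {α β : ℝ} (h : α < β) : Function.Injective (location α β) := by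
  rintro ⟨_ | x, l⟩ ⟨_ | y, l'⟩ hxy
  · cases l <;> cases l' <;> simp [location, h.ne, h.ne'] at hxy ⊢
  · exact absurd (congrArg Prod.fst hxy).symm (vertexR_ne_zero y)
  · exact absurd (congrArg Prod.fst hxy) (vertexR_ne_zero x)
  · obtain rfl := vertexR_injective (congrArg Prod.fst hxy)
    cases l <;> cases l' <;> simp [location] at hxy ⊢

/-- The labelling of the points as an embedding. -/
def locate {α β : ℝ} (h : α < β) : Label ↪ (Fin 4 → ℝ) × ℝ :=
  ⟨location α β, location_injective h⟩

theorem range_vertexR : Set.range vertexR = cell24 := by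
  have hs : ∀ (i : Fin 4) (c : ℤ),
      (fun k => ((Pi.single i c : Fin 4 → ℤ) k : ℝ)) = Pi.single i (c : ℝ) := by
    intro i c
    ext k
    by_cases hk : k = i
    · subst hk; simp
    · simp [hk]
  ext v
  constructor
  · rintro ⟨x, rfl⟩
    rcases vertexZ_mem x with ⟨i, h | h⟩ | h
    · exact .inl ⟨i, .inl (by unfold vertexR; rw [h, hs]; norm_num)⟩
    · exact .inl ⟨i, .inr (by unfold vertexR; rw [h, hs]; norm_num)⟩
    · refine .inr fun i => (h i).imp (fun h => ?_) fun h => ?_ <;> simp [vertexR, h]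
  · rintro (⟨i, rfl | rfl⟩ | h)
    · obtain ⟨x, hx⟩ := (exists_vertexZ_eq_single i).1
      exact ⟨x, by unfold vertexR; rw [hx, hs]; norm_num⟩
    · obtain ⟨x, hx⟩ := (exists_vertexZ_eq_single i).2
      exact ⟨x, by unfold vertexR; rw [hx, hs]; norm_num⟩
    · have hb : ∀ i, ∃ b : Bool, v i = if b then 1 else -1 := fun i =>
        (h i).elim (fun h => ⟨true, by simp [h]⟩) fun h => ⟨false, by simp [h]⟩
      choose b hb using hb
      obtain ⟨x, hx⟩ := exists_vertexZ_eq_sign (b 0) (b 1) (b 2) (b 3)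
      refine ⟨x, funext fun k => ?_⟩
      unfold vertexR
      rw [hx, hb]
      fin_cases k <;> simp

theorem range_location (α β : ℝ) : Set.range (location α β) = movedA50 α β := by
  ext ⟨p, t⟩
  simp only [movedA50, pointsA50, ← range_vertexR, Set.mem_range, Set.mem_union, Set.mem_sdiff,
    Set.mem_prod, Set.mem_insert_iff, Set.mem_singleton_iff, Prod.mk.injEq]
  constructor
  · rintro ⟨⟨_ | x, l⟩, h⟩
    · right
      cases l <;> simp_all [location]
    · left
      obtain ⟨rfl, rfl⟩ := Prod.mk.inj h
      refine ⟨⟨.inl ⟨x, rfl⟩, ?_⟩, ?_⟩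
      · cases l <;> simp
      · simp [vertexR_ne_zero]
  · rintro (⟨⟨⟨x, rfl⟩ | rfl, rfl | rfl⟩, h⟩ | ⟨rfl, rfl⟩ | ⟨rfl, rfl⟩)
    · exact ⟨(some x, false), by simp [location]⟩
    · exact ⟨(some x, true), by simp [location]⟩
    · simp at h
    · simp at h
    · exact ⟨(none, false), by simp [location]⟩
    · exact ⟨(none, true), by simp [location]⟩

/-! ### Convex combinations of the configuration -/

/-- The total weight of the two copies of a vertex of the 24-cell. -/
def columnWeight (w : Label → ℝ) (x : Fin 24) : ℝ := w (some x, false) + w (some x, true)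

theorem sum_weights (w : Label → ℝ) :
    ∑ i, w i = ∑ x, columnWeight w x + (w (none, false) + w (none, true)) := by
  rw [Fintype.sum_prod_type, Fintype.sum_option]
  simp only [Fintype.sum_bool, columnWeight]
  rw [add_comm]
  congr 1
  · exact Finset.sum_congr rfl fun x _ => add_comm _ _
  · exact add_comm _ _

theorem sum_smul_location_fst_dot {α β : ℝ} (w : Label → ℝ) (g : Fin 4 → ℝ) :
    (∑ i, w i • location α β i).1 ⬝ᵥ g = ∑ x, columnWeight w x * (vertexR x ⬝ᵥ g) := by
  rw [Prod.fst_sum, sum_dotProduct, Fintype.sum_prod_type, Fintype.sum_option]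
  simp [location, columnWeight, add_mul, add_comm]

theorem sum_smul_location_snd {α β : ℝ} (w : Label → ℝ) :
    (∑ i, w i • location α β i).2 =
      ∑ x, w (some x, true) + (w (none, false) * α + w (none, true) * β) := by
  rw [Prod.snd_sum, Fintype.sum_prod_type, Fintype.sum_option]
  simp [location]
  ring

theorem columnWeight_nonneg {w : Label → ℝ} (hw : ∀ i, 0 ≤ w i) (x : Fin 24) :
    0 ≤ columnWeight w x := add_nonneg (hw _) (hw _)

/-- The prism over a clique of the 24-cell is a face of the configuration, on which the column
weights of a convex combination are determined by the point. -/
theorem columnWeight_of_clique {α β : ℝ} {C : Finset (Fin 24)}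
    (hC : ∀ x ∈ C, ∀ y ∈ C, x ≠ y → CellAdj x y) {w : Label → ℝ} (hw : ∀ i, 0 ≤ w i)
    (hw1 : ∑ i, w i = 1)
    (hq : ∑ c ∈ C, (∑ i, w i • location α β i).1 ⬝ᵥ vertexR c = 2 * C.card + 2) :
    (∀ x ∉ C, columnWeight w x = 0) ∧ w (none, false) = 0 ∧ w (none, true) = 0 ∧
      ∀ c ∈ C, columnWeight w c = (∑ i, w i • location α β i).1 ⬝ᵥ vertexR c / 2 - 1 := by
  set k : ℝ := (C.card : ℝ) with hk
  have hk0 : 0 ≤ k := by positivity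
  have hin : ∀ y ∈ C, ∑ c ∈ C, vertexR y ⬝ᵥ vertexR c = 2 * k + 2 := by
    intro y hy
    have h1 : ∀ c ∈ C, vertexR y ⬝ᵥ vertexR c = 2 + if y = c then 2 else 0 := by
      intro c hc
      split_ifs with h
      · rw [← h, vertexR_dot_self]; norm_num
      · rw [(hC y hy c hc h).dot_eq, add_zero]
    rw [Finset.sum_congr rfl h1, Finset.sum_add_distrib, Finset.sum_ite_eq, if_pos hy]
    simp [hk, mul_comm]
  have hout : ∀ y ∉ C, ∑ c ∈ C, vertexR y ⬝ᵥ vertexR c ≤ 2 * k := by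
    intro y hy
    refine (Finset.sum_le_card_nsmul C _ 2 fun c hc =>
      vertexR_dot_le (by rintro rfl; exact hy hc)).trans ?_
    simp [hk, mul_comm]
  simp only [sum_smul_location_fst_dot] at hq ⊢
  rw [Finset.sum_comm] at hq
  simp only [← Finset.mul_sum] at hq
  rw [sum_weights] at hw1
  have hterm : ∀ x, 0 ≤ columnWeight w x * (2 * k + 2 - ∑ c ∈ C, vertexR x ⬝ᵥ vertexR c) := by
    intro x
    refine mul_nonneg (columnWeight_nonneg hw x) ?_
    by_cases hx : x ∈ C
    · rw [hin x hx]; simp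
    · linarith [hout x hx]
  have htot : ∑ x, columnWeight w x * (2 * k + 2 - ∑ c ∈ C, vertexR x ⬝ᵥ vertexR c) =
      - (2 * k + 2) * (w (none, false) + w (none, true)) := by
    simp only [mul_sub, Finset.sum_sub_distrib, ← Finset.sum_mul, hq]
    linear_combination (2 * k + 2) * hw1
  have hn0 := hw (none, false)
  have hn1 := hw (none, true)
  have hsum := Finset.sum_nonneg fun x (_ : x ∈ Finset.univ) => hterm x
  have hz : w (none, false) + w (none, true) = 0 := by nlinarith
  have hall := (Finset.sum_eq_zero_iff_of_nonneg fun x _ => hterm x).1 (by rw [htot, hz, mul_zero])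
  have hC0 : ∀ x ∉ C, columnWeight w x = 0 := fun x hx =>
    (mul_eq_zero.1 (hall x (Finset.mem_univ x))).resolve_right (by linarith [hout x hx])
  refine ⟨hC0, by linarith, by linarith, fun c hc => ?_⟩
  have h1 : ∀ x, columnWeight w x * (vertexR x ⬝ᵥ vertexR c) =
      2 * columnWeight w x + if c = x then 2 * columnWeight w c else 0 := by
    intro x
    by_cases hx : x ∈ C
    · split_ifs with h
      · rw [h, vertexR_dot_self]; ring
      · rw [(hC x hx c hc (Ne.symm h)).dot_eq]; ring
    · rw [hC0 x hx, if_neg (by rintro rfl; exact hx hc)]; ring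
  rw [Finset.sum_congr rfl fun x _ => h1 x, Finset.sum_add_distrib, Finset.sum_ite_eq,
    if_pos (Finset.mem_univ _), ← Finset.mul_sum]
  linarith

theorem IsTriangulation.exists_weights {α β : ℝ} (h : α < β)
    {K : Geometry.SimplicialComplex ℝ ((Fin 4 → ℝ) × ℝ)} (hK : IsTriangulation (movedA50 α β) K)
    {q : (Fin 4 → ℝ) × ℝ} (hq : q ∈ convexHull ℝ (movedA50 α β)) :
    ∃ w : Label → ℝ, (∀ i, 0 ≤ w i) ∧ ∑ i, w i = 1 ∧ ∑ i, w i • location α β i = q ∧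
      ∀ T : Finset Label, T.Nonempty → (∀ i ∈ T, w i ≠ 0) → T.map (locate h) ∈ K.faces := by
  rw [← hK.2, Geometry.SimplicialComplex.mem_space_iff] at hq
  obtain ⟨σ, hσ, hq⟩ := hq
  have hσA : (σ : Set _) ⊆ Set.range (location α β) := by
    rw [range_location]
    refine Set.Subset.trans ?_ hK.1
    rw [Geometry.SimplicialComplex.vertices_eq]
    exact fun v hv => Set.mem_biUnion hσ hv
  obtain ⟨S, -, rfl⟩ := Finset.subset_map_iff.1 (show σ ⊆ Finset.univ.map (locate h) by
    intro y hy
    obtain ⟨i, rfl⟩ := hσA hy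
    exact Finset.mem_map_of_mem _ (Finset.mem_univ i))
  obtain ⟨w, h0, hS, h1, rfl⟩ := mem_convexHull_map_iff.1 hq
  exact ⟨w, h0, h1, rfl, fun T hT hTw => K.down_closed hσ
    (Finset.map_subset_map.2 fun i hi => hS i (hTw i hi)) (by simpa using hT)⟩

/-! ### Orientations are preserved by flips -/

/-- The diagonal from the lower copy of `x` to the upper copy of `y`, in the square over an edge
`xy` of the 24-cell. -/
def diagonal (x y : Fin 24) : Finset Label := {(some x, false), (some y, true)}

theorem diagonal_nonempty (x y : Fin 24) : (diagonal x y).Nonempty := ⟨_, Finset.mem_insert_self _ _⟩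

section Flips

variable {α β : ℝ} (h : α < β) {K K' : Geometry.SimplicialComplex ℝ ((Fin 4 → ℝ) × ℝ)}

/-- A triangulation induces the orientation `o` if it contains, in the square over each edge `xy`
directed from `x` to `y`, the diagonal from the lower copy of `x` to the upper copy of `y`. -/
def Induces (o : Option (Fin 3 × Bool × Bool))
    (K : Geometry.SimplicialComplex ℝ ((Fin 4 → ℝ) × ℝ)) : Prop :=
  ∀ x y, DirEdge o x y → (diagonal x y).map (locate h) ∈ K.faces

theorem location_mem (i : Label) : location α β i ∈ movedA50 α β := by
  rw [← range_location]; exact ⟨i, rfl⟩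

theorem IsTriangulation.exists_diagonal (hK : IsTriangulation (movedA50 α β) K) {x y : Fin 24}
    (hxy : CellAdj x y) :
    (diagonal x y).map (locate h) ∈ K.faces ∨ (diagonal y x).map (locate h) ∈ K.faces := by
  have hq : (1 / 2 : ℝ) • location α β (some x, false) + (1 / 2 : ℝ) • location α β (some y, true) ∈
      convexHull ℝ (movedA50 α β) :=
    (convex_convexHull ℝ _) (subset_convexHull ℝ _ (location_mem _))
      (subset_convexHull ℝ _ (location_mem _)) (by norm_num) (by norm_num) (by norm_num)
  obtain ⟨w, h0, h1, hw, hT⟩ := hK.exists_weights h hq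
  have hne := hxy.ne
  have hdx : (∑ i, w i • location α β i).1 ⬝ᵥ vertexR x = 3 := by
    rw [hw]
    simp only [location, Prod.fst_add, Prod.smul_fst, add_dotProduct, smul_dotProduct,
      vertexR_dot_self, hxy.symm.dot_eq, smul_eq_mul]
    norm_num
  have hdy : (∑ i, w i • location α β i).1 ⬝ᵥ vertexR y = 3 := by
    rw [hw]
    simp only [location, Prod.fst_add, Prod.smul_fst, add_dotProduct, smul_dotProduct,
      vertexR_dot_self, hxy.dot_eq, smul_eq_mul]
    norm_num
  obtain ⟨hC0, hn0, hn1, hCw⟩ := columnWeight_of_clique (α := α) (β := β) (C := {x, y}) (by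
    simp only [Finset.mem_insert, Finset.mem_singleton]
    rintro a (rfl | rfl) b (rfl | rfl) hab
    · exact absurd rfl hab
    · exact hxy
    · exact hxy.symm
    · exact absurd rfl hab) h0 h1 (by
    rw [Finset.sum_pair hne, hdx, hdy, Finset.card_pair hne]; norm_num)
  have hx := hCw x (by simp)
  have hy := hCw y (by simp)
  rw [hdx] at hx
  rw [hdy] at hy
  have hs := congrArg Prod.snd hw
  rw [sum_smul_location_snd, hn0, hn1] at hs
  have hs' : ∑ v, w (some v, true) = w (some x, true) + w (some y, true) := by
    rw [← Finset.sum_pair hne (f := fun v => w (some v, true))]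
    refine (Finset.sum_subset (Finset.subset_univ _) fun v _ hv => ?_).symm
    have := hC0 v hv
    unfold columnWeight at this
    linarith [h0 (some v, true), h0 (some v, false)]
  rw [hs'] at hs
  simp [location] at hs
  unfold columnWeight at hx hy
  by_cases hd : w (some x, false) ≠ 0 ∧ w (some y, true) ≠ 0
  · refine .inl (hT _ (diagonal_nonempty _ _) ?_)
    simp [diagonal, hd]
  · refine .inr (hT _ (diagonal_nonempty _ _) ?_)
    simp only [diagonal, Finset.mem_insert, Finset.mem_singleton, forall_eq_or_imp, forall_eq]
    by_cases hd1 : w (some x, false) = 0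
    · constructor <;> intro h <;> linarith
    · have hd2 : w (some y, true) = 0 := by tauto
      constructor <;> intro h <;> linarith

theorem half_add_half_mem_convexHull {σ : Finset Label} {i j : Label} (hi : i ∈ σ) (hj : j ∈ σ) :
    (1 / 2 : ℝ) • location α β i + (1 / 2 : ℝ) • location α β j ∈
      convexHull ℝ (σ.map (locate h) : Set ((Fin 4 → ℝ) × ℝ)) :=
  (convex_convexHull ℝ _) (subset_convexHull ℝ _ (Finset.mem_map_of_mem (locate h) hi))
    (subset_convexHull ℝ _ (Finset.mem_map_of_mem (locate h) hj))
    (by norm_num) (by norm_num) (by norm_num)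

open Classical in
theorem not_both_diagonals {x y : Fin 24} (hxy : x ≠ y)
    (h1 : (diagonal x y).map (locate h) ∈ K.faces) :
    (diagonal y x).map (locate h) ∉ K.faces := by
  intro h2
  have e : (1 / 2 : ℝ) • location α β (some y, false) + (1 / 2 : ℝ) • location α β (some x, true) =
      (1 / 2 : ℝ) • location α β (some x, false) + (1 / 2 : ℝ) • location α β (some y, true) := by
    ext <;> simp [location, add_comm]
  have m1 := half_add_half_mem_convexHull h (σ := diagonal x y) (i := (some x, false))
    (j := (some y, true)) (by simp [diagonal]) (by simp [diagonal])
  have m2 := half_add_half_mem_convexHull h (σ := diagonal y x) (i := (some y, false))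
    (j := (some x, true)) (by simp [diagonal]) (by simp [diagonal])
  rw [e] at m2
  have h3 := K.inter_subset_convexHull h1 h2 ⟨m1, m2⟩
  rw [← Finset.coe_inter, ← Finset.map_inter] at h3
  have h4 : diagonal x y ∩ diagonal y x = ∅ := by
    ext i
    simp only [diagonal, Finset.mem_inter, Finset.mem_insert, Finset.mem_singleton,
      Finset.notMem_empty, iff_false, not_and, not_or]
    rintro (rfl | rfl) <;> simp [hxy, hxy.symm]
  rw [h4] at h3
  simp at h3

/-- In the prism over a triangle with `x → z → y`, the three diagonals force the simplex that
contains the diagonal over `xy` and the lower copies of all three vertices. -/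
theorem IsTriangulation.mem_of_directed_triangle (hK : IsTriangulation (movedA50 α β) K)
    {x y z : Fin 24} (hxy : CellAdj x y) (hxz : CellAdj x z) (hzy : CellAdj z y)
    (dxy : (diagonal x y).map (locate h) ∈ K.faces) (dxz : (diagonal x z).map (locate h) ∈ K.faces)
    (dzy : (diagonal z y).map (locate h) ∈ K.faces) :
    ({(some x, false), (some y, false), (some y, true), (some z, false)} : Finset Label).map
      (locate h) ∈ K.faces := by
  set q : (Fin 4 → ℝ) × ℝ := ∑ i : Fin 4, (1 / 4 : ℝ) • location α β
    (![(some x, false), (some y, false), (some y, true), (some z, false)] i) with hqdef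
  have hq : q ∈ convexHull ℝ (movedA50 α β) :=
    sum_smul_mem_convexHull _ _ (fun _ => by norm_num) (by simp) fun i _ => location_mem _
  obtain ⟨w, h0, h1, hw, hT⟩ := hK.exists_weights h hq
  have hq1 : q.1 = (1 / 4 : ℝ) • vertexR x + (1 / 2 : ℝ) • vertexR y + (1 / 4 : ℝ) • vertexR z := by
    rw [hqdef, Fin.sum_univ_four]
    ext k
    simp [location]
    ring
  have hq2 : q.2 = 1 / 4 := by
    rw [hqdef, Fin.sum_univ_four]
    simp [location]
  have hdx : (∑ i, w i • location α β i).1 ⬝ᵥ vertexR x = 5 / 2 := by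
    rw [hw, hq1]
    simp only [add_dotProduct, smul_dotProduct, vertexR_dot_self, hxy.symm.dot_eq,
      hxz.symm.dot_eq, smul_eq_mul]
    norm_num
  have hdy : (∑ i, w i • location α β i).1 ⬝ᵥ vertexR y = 3 := by
    rw [hw, hq1]
    simp only [add_dotProduct, smul_dotProduct, vertexR_dot_self, hxy.dot_eq,
      hzy.dot_eq, smul_eq_mul]
    norm_num
  have hdz : (∑ i, w i • location α β i).1 ⬝ᵥ vertexR z = 5 / 2 := by
    rw [hw, hq1]
    simp only [add_dotProduct, smul_dotProduct, vertexR_dot_self, hxz.dot_eq,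
      hzy.symm.dot_eq, smul_eq_mul]
    norm_num
  have hx : x ∉ ({y, z} : Finset (Fin 24)) := by simp [hxy.ne, hxz.ne]
  have hy : y ∉ ({z} : Finset (Fin 24)) := by simp [hzy.ne.symm]
  obtain ⟨hC0, hn0, hn1, hCw⟩ := columnWeight_of_clique (α := α) (β := β) (C := {x, y, z}) (by
    simp only [Finset.mem_insert, Finset.mem_singleton]
    rintro a (rfl | rfl | rfl) b (rfl | rfl | rfl) hab <;>
      first | exact absurd rfl hab | assumption | exact CellAdj.symm (by assumption)) h0 h1 (by
    rw [Finset.sum_insert hx, Finset.sum_insert hy, Finset.sum_singleton, hdx, hdy, hdz,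
      Finset.card_insert_of_notMem hx, Finset.card_insert_of_notMem hy, Finset.card_singleton]
    norm_num)
  have hx' := hCw x (by simp)
  have hy' := hCw y (by simp)
  have hz' := hCw z (by simp)
  rw [hdx] at hx'
  rw [hdy] at hy'
  rw [hdz] at hz'
  have hs := congrArg Prod.snd hw
  rw [sum_smul_location_snd, hn0, hn1, hq2] at hs
  have hs' : ∑ v, w (some v, true) = w (some x, true) + (w (some y, true) + w (some z, true)) := by
    have h3 : ∑ v ∈ ({x, y, z} : Finset (Fin 24)), w (some v, true) =
        w (some x, true) + (w (some y, true) + w (some z, true)) := by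
      rw [Finset.sum_insert hx, Finset.sum_insert hy, Finset.sum_singleton]
    rw [← h3]
    refine (Finset.sum_subset (Finset.subset_univ _) fun v _ hv => ?_).symm
    have := hC0 v hv
    unfold columnWeight at this
    linarith [h0 (some v, true), h0 (some v, false)]
  rw [hs'] at hs
  unfold columnWeight at hx' hy' hz'
  have key : ∀ {a b : Fin 24}, CellAdj a b → (diagonal a b).map (locate h) ∈ K.faces →
      w (some b, false) = 0 ∨ w (some a, true) = 0 := by
    intro a b hab hd
    by_contra! hne
    refine not_both_diagonals h hab.ne hd (hT _ (diagonal_nonempty _ _) ?_)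
    simpa [diagonal] using hne
  have ky := hy'
  have hyf : w (some y, false) ≠ 0 := by
    intro h
    linarith [h0 (some x, true), h0 (some z, true)]
  have hxt := (key hxy dxy).resolve_left hyf
  have hzt := (key hzy dzy).resolve_left hyf
  refine hT _ ⟨_, Finset.mem_insert_self _ _⟩ ?_
  simp only [Finset.mem_insert, Finset.mem_singleton, forall_eq_or_imp, forall_eq]
  refine ⟨?_, hyf, ?_, ?_⟩ <;> intro h <;> linarith

end Flips

section Exchange

variable {E : Type*}

/-- The part of the definition of a flip that does not change when the two triangulations are
swapped: simplices that are lost contain `N`, simplices that are gained contain `P`, and both are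
joins with a simplex of the link `L`. -/
structure IsExchange (K K' : Set (Finset E)) (Z P N : Finset E) (L : Set (Finset E)) : Prop where
  join_mem : ∀ S ⊆ Z, ¬ P ⊆ S → ∀ R ∈ L, ∀ σ : Finset E, (∀ v ∈ σ, v ∈ S ∨ v ∈ R) → σ ∈ K
  join_mem' : ∀ S ⊆ Z, ¬ N ⊆ S → ∀ R ∈ L, ∀ σ : Finset E, (∀ v ∈ σ, v ∈ S ∨ v ∈ R) → σ ∈ K'
  lost : ∀ σ ∈ K, σ ∉ K' → N ⊆ σ ∧ ∃ S ⊆ Z, ∃ R ∈ L, ∀ v ∈ σ, v ∈ S ∨ v ∈ R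
  gained : ∀ σ ∈ K', σ ∉ K → P ⊆ σ ∧ ∃ S ⊆ Z, ∃ R ∈ L, ∀ v ∈ σ, v ∈ S ∨ v ∈ R

theorem IsExchange.symm {K K' : Set (Finset E)} {Z P N : Finset E} {L : Set (Finset E)}
    (h : IsExchange K K' Z P N L) : IsExchange K' K Z N P L :=
  ⟨h.join_mem', h.join_mem, h.gained, h.lost⟩

theorem mem_allSimplices_of_subset [AddCommGroup E] [Module ℝ E]
    {K : Geometry.SimplicialComplex ℝ E} {σ τ : Finset E} (hτ : τ ∈ allSimplices K) (h : σ ⊆ τ) :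
    σ ∈ allSimplices K := by
  rcases σ.eq_empty_or_nonempty with h0 | h0
  · exact .inl h0
  · rcases hτ with rfl | hτ
    · exact absurd (Finset.subset_empty.1 h) h0.ne_empty
    · exact .inr (K.down_closed hτ h h0)

open Classical in
theorem IsFlip.isExchange [AddCommGroup E] [Module ℝ E] {A : Set E} {K K' : Geometry.SimplicialComplex ℝ E}
    (h : IsFlip A K K') : ∃ (P N Z : Finset E) (L : Set (Finset E)),
      P ⊆ Z ∧ N ⊆ Z ∧ (∀ v ∈ Z, v ∈ P ∨ v ∈ N) ∧
      (convexHull ℝ (P : Set E) ∩ convexHull ℝ (N : Set E)).Nonempty ∧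
        IsExchange (allSimplices K) (allSimplices K') Z P N L := by
  obtain ⟨P, N, ⟨hPN, -, -, -, hne⟩, -, L, hL, hK'⟩ := h
  have hjoin : ∀ S ⊆ P ∪ N, ¬ P ⊆ S → ∀ R ∈ L, S ∪ R ∈ allSimplices K := by
    intro S hS hPS R hR
    obtain ⟨p, hp, hpS⟩ := Finset.not_subset.1 hPS
    have hmax : Maximal (· ∈ circuitTriangulation P N) ((P ∪ N).erase p) := by
      refine ⟨⟨Finset.erase_subset _ _, fun h => by simpa using h hp⟩, ?_⟩
      rintro T ⟨hT, hPT⟩ hle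
      have hpT : p ∉ T := fun hpT => hPT fun i hi => by
        by_cases hip : i = p
        · rwa [hip]
        · exact hle (by simp [hip, hi])
      exact fun i hi => Finset.mem_erase.2 ⟨by rintro rfl; exact hpT hi, hT hi⟩
    have hR' := (hL _ hmax).symm ▸ hR
    have hmem : R ∪ (P ∪ N).erase p ∈ allSimplices K := hR'.2
    have hsub : S ∪ R ⊆ R ∪ (P ∪ N).erase p := Finset.union_subset
      (fun i hi => Finset.mem_union_right _
        (Finset.mem_erase.2 ⟨by rintro rfl; exact hpS hi, hS hi⟩)) Finset.subset_union_left
    exact mem_allSimplices_of_subset hmem hsub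
  have hjoin' : ∀ S ⊆ P ∪ N, ¬ N ⊆ S → ∀ R ∈ L, S ∪ R ∈ allSimplices K' := by
    intro S hS hNS R hR
    rw [hK']
    exact .inr ⟨S, ⟨by rwa [Finset.union_comm N], hNS⟩, R, hR, rfl⟩
  have hun : ∀ {S R σ : Finset E}, (∀ v ∈ σ, v ∈ S ∨ v ∈ R) → σ ⊆ S ∪ R :=
    fun h v hv => Finset.mem_union.2 (h v hv)
  refine ⟨P, N, P ∪ N, L, Finset.subset_union_left, Finset.subset_union_right,
    fun v hv => Finset.mem_union.1 hv, hne,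
    fun S hS hPS R hR σ hσ => mem_allSimplices_of_subset (hjoin S hS hPS R hR) (hun hσ),
    fun S hS hNS R hR σ hσ => mem_allSimplices_of_subset (hjoin' S hS hNS R hR) (hun hσ), ?_, ?_⟩
  · intro σ hσ hσ'
    have hj : σ ∈ simplexJoin (circuitTriangulation P N) L := by
      by_contra hj
      exact hσ' (hK' ▸ .inl ⟨hσ, hj⟩)
    obtain ⟨S, ⟨hS, hPS⟩, R, hR, rfl⟩ := hj
    refine ⟨?_, S, hS, R, hR, fun v hv => Finset.mem_union.1 hv⟩
    by_contra hN
    exact hσ' (hjoin' S hS (fun h => hN (h.trans Finset.subset_union_left)) R hR)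
  · intro σ hσ' hσ
    rw [hK'] at hσ'
    rcases hσ' with ⟨h, -⟩ | ⟨S, ⟨hS, hNS⟩, R, hR, rfl⟩
    · exact absurd h hσ
    · rw [Finset.union_comm N] at hS
      refine ⟨?_, S, hS, R, hR, fun v hv => Finset.mem_union.1 hv⟩
      by_contra hP
      exact hσ (hjoin S hS (fun h => hP (h.trans Finset.subset_union_left)) R hR)

end Exchange

section Invariance

variable {α β : ℝ} (h : α < β) {K K' : Geometry.SimplicialComplex ℝ ((Fin 4 → ℝ) × ℝ)}

theorem mem_allSimplices_map {T : Finset Label} (hT : T.Nonempty) :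
    T.map (locate h) ∈ allSimplices K ↔ T.map (locate h) ∈ K.faces := by
  simp [allSimplices, hT.ne_empty]

/-- Disjoint pieces of the two diagonals of a square intersect only if they are the diagonals. -/
theorem eq_diagonal_of_inter {x y : Fin 24} (hxy : x ≠ y) {P N : Finset ((Fin 4 → ℝ) × ℝ)}
    (hP : P ⊆ (diagonal y x).map (locate h)) (hN : N ⊆ (diagonal x y).map (locate h))
    (hne : (convexHull ℝ (P : Set _) ∩ convexHull ℝ (N : Set ((Fin 4 → ℝ) × ℝ))).Nonempty) :
    location α β (some x, true) ∈ P ∧ location α β (some y, false) ∈ P := by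
  obtain ⟨c, hcP, hcN⟩ := hne
  have hcN' := convexHull_mono (Finset.coe_subset.2 hN) hcN
  simp only [diagonal, Finset.map_insert, Finset.map_singleton, Finset.coe_insert,
    Finset.coe_singleton, convexHull_pair] at hcN'
  obtain ⟨a, b, ha, hb, hab, rfl⟩ := hcN'
  have hpt : ∀ i, P ⊆ {location α β i} →
      a • location α β (some x, false) + b • location α β (some y, true) = location α β i := by
    intro i hi
    simpa [locate] using convexHull_mono (Finset.coe_subset.2 hi) hcP
  have hPsub : ∀ v ∈ P, v = location α β (some y, false) ∨ v = location α β (some x, true) := by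
    intro v hv
    simpa [diagonal, locate] using hP hv
  constructor
  · by_contra hv
    have h1 := hpt (some y, false) fun v hv' => by
      rcases hPsub v hv' with rfl | rfl
      · simp
      · exact absurd hv' hv
    have h2 : b = 0 := by simpa [location] using congrArg Prod.snd h1
    obtain rfl : a = 1 := by linarith
    rw [h2, one_smul, zero_smul, add_zero] at h1
    exact hxy (by simpa using location_injective h h1)
  · by_contra hv
    have h1 := hpt (some x, true) fun v hv' => by
      rcases hPsub v hv' with rfl | rfl
      · exact absurd hv' hv
      · simp
    have h2 : b = 1 := by simpa [location] using congrArg Prod.snd h1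
    obtain rfl : a = 0 := by linarith
    rw [h2, one_smul, zero_smul, zero_add] at h1
    exact hxy (by simpa using (location_injective h h1).symm)

/-- If every edge is the long edge of a directed triangle, no diagonal can be flipped: the link
of the simplices of the flip in that triangle's prism would contain a lower vertex that cannot be
joined to one of the ends of the new diagonal. -/
theorem IsExchange.induces {m : Fin 3 × Bool × Bool} (hK : IsTriangulation (movedA50 α β) K)
    (hK' : IsTriangulation (movedA50 α β) K') {P N : Finset ((Fin 4 → ℝ) × ℝ)}
    {Z : Finset ((Fin 4 → ℝ) × ℝ)} {L : Set (Finset ((Fin 4 → ℝ) × ℝ))}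
    (hPZ : P ⊆ Z) (hZ : ∀ v ∈ Z, v ∈ P ∨ v ∈ N)
    (hne : (convexHull ℝ (P : Set _) ∩ convexHull ℝ (N : Set ((Fin 4 → ℝ) × ℝ))).Nonempty)
    (hex : IsExchange (allSimplices K) (allSimplices K') Z P N L)
    (ho : Induces h (some m) K) : Induces h (some m) K' := by
  intro x y hxy
  by_contra hD
  obtain ⟨z, hxz, hzy⟩ := hxy.exists_between
  have hxyne := hxy.1.ne
  have dK := ho x y hxy
  have dK' := (hK'.exists_diagonal h hxy.1).resolve_left hD
  have hNsub := (hex.lost _ ((mem_allSimplices_map h (diagonal_nonempty _ _)).2 dK)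
    ((mem_allSimplices_map h (diagonal_nonempty _ _)).not.2 hD)).1
  have hPsub := (hex.gained _ ((mem_allSimplices_map h (diagonal_nonempty _ _)).2 dK')
    ((mem_allSimplices_map h (diagonal_nonempty _ _)).not.2
      (not_both_diagonals h hxyne dK))).1
  obtain ⟨hx1, hy0⟩ := eq_diagonal_of_inter h hxyne hPsub hNsub hne
  have hτ := hK.mem_of_directed_triangle h hxy.1 hxz.1 hzy.1 dK (ho x z hxz) (ho z y hzy)
  set τ : Finset Label := {(some x, false), (some y, false), (some y, true), (some z, false)}
  have hτne : τ.Nonempty := ⟨_, Finset.mem_insert_self _ _⟩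
  have hτ' : τ.map (locate h) ∉ K'.faces := fun hτ' => hD <| K'.down_closed hτ'
    (Finset.map_subset_map.2 (by intro i; simp only [diagonal, τ]; grind))
    (by simpa using diagonal_nonempty x y)
  obtain ⟨-, S, hS, R, hR, hSR⟩ := hex.lost _ ((mem_allSimplices_map h hτne).2 hτ)
    ((mem_allSimplices_map h hτne).not.2 hτ')
  have hzR : location α β (some z, false) ∈ R := by
    have hz := Finset.mem_map_of_mem (locate h)
      (show ((some z, false) : Label) ∈ τ by simp [τ])
    refine (hSR _ hz).resolve_left fun hzS => ?_
    have hmem : ∀ {a b : Fin 24}, a ≠ z →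
        location α β (some z, false) ∉ (diagonal a b).map (locate h) := by
      intro a b ha hm
      obtain ⟨i, hi, hiz⟩ := Finset.mem_map.1 hm
      obtain rfl := location_injective h hiz
      simp [diagonal, ha.symm] at hi
    rcases hZ _ (hS hzS) with hz | hz
    · exact hmem hzy.1.ne.symm (hPsub hz)
    · exact hmem hxz.1.ne (hNsub hz)
  have hzx := hex.join_mem {location α β (some x, true)} (by simpa using hPZ hx1)
    (fun hP => by
      have := location_injective h (Finset.mem_singleton.1 (hP hy0))
      simp at this) R hR ((diagonal z x).map (locate h)) (by
    intro v hv
    obtain ⟨i, hi, rfl⟩ := Finset.mem_map.1 hv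
    rcases Finset.mem_insert.1 hi with rfl | hi
    · exact .inr hzR
    · rw [Finset.mem_singleton.1 hi]
      exact .inl (Finset.mem_singleton_self _))
  rw [mem_allSimplices_map h (diagonal_nonempty _ _)] at hzx
  exact not_both_diagonals h hxz.1.ne (ho x z hxz) hzx

/-- The orientation induced by a triangulation is constant on its component in the graph of
triangulations. -/
theorem Induces.of_reachable {m : Fin 3 × Bool × Bool} {T T' : Triangulation (movedA50 α β)}
    (hr : (triangulationGraph (movedA50 α β)).Reachable T T') (ho : Induces h (some m) T.1) :
    Induces h (some m) T'.1 := by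
  classical
  obtain ⟨p⟩ := hr
  induction p with
  | nil => exact ho
  | cons hadj _ ih =>
    refine ih ?_
    rcases (SimpleGraph.fromRel_adj _ _ _).1 hadj with ⟨-, hf | hf⟩
    · obtain ⟨P, N, Z, L, hP, hN, hZ, hne, hex⟩ := hf.isExchange
      exact hex.induces h (Subtype.prop _) (Subtype.prop _) hP hZ hne ho
    · obtain ⟨P, N, Z, L, hP, hN, hZ, hne, hex⟩ := hf.isExchange
      rw [Set.inter_comm] at hne
      exact hex.symm.induces h (Subtype.prop _) (Subtype.prop _) hN (fun v hv => (hZ v hv).symm) hne ho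

end Invariance

/-! ### Triangulations of the prism over an octahedron -/

section OctahedralPrism

/-- Weights on the twelve vertices of the prism over an octahedron: `u i b l` belongs to the end `b`
of the axis `i` at the level `l`. -/
abbrev PrismWeight := Fin 3 → Bool → Bool → ℝ

/-- The total weight of the two copies of a vertex of the octahedron. -/
def PrismWeight.col (u : PrismWeight) (i : Fin 3) (b : Bool) : ℝ := u i b false + u i b true

/-- The support lies in a simplex of the join of the upper copy of the sink `(0, true)` and the
lower octahedron, triangulated around its axis `k`. -/
structure IsLower (k : Fin 3) (u : PrismWeight) : Prop where
  source : u 0 false true = 0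
  upper : ∀ i, i ≠ 0 → ∀ b, u i b true = 0
  axis : ∀ i, i ≠ k → u i false false = 0 ∨ u i true false = 0

/-- The support lies in a simplex of the join of the lower copy of the source `(0, false)` and the
upper octahedron, triangulated around its axis `k`. -/
structure IsUpper (k : Fin 3) (u : PrismWeight) : Prop where
  sink : u 0 true false = 0
  lower : ∀ i, i ≠ 0 → ∀ b, u i b false = 0
  axis : ∀ i, i ≠ k → u i false true = 0 ∨ u i true true = 0

/-- The support lies in a simplex of the join of the lower source, the upper sink, and the
triangulated squares over the edges of the equator. The edge between the end `b` of the axis `1` and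
the end `b'` of the axis `2` is directed from the former to the latter iff `e b b'`. -/
structure IsMiddle (e : Bool → Bool → Prop) (u : PrismWeight) : Prop where
  source : u 0 false true = 0
  sink : u 0 true false = 0
  axis : ∀ i, i ≠ 0 → (∀ l, u i false l = 0) ∨ ∀ l, u i true l = 0
  pos : ∀ b b', e b b' → u 1 b true = 0 ∨ u 2 b' false = 0
  neg : ∀ b b', ¬ e b b' → u 2 b' true = 0 ∨ u 1 b false = 0

/-- Equality of the coordinates of the points that are represented by two weights: the total
weight, the coordinates along the three axes, and the height. -/
structure SamePoint (u v : PrismWeight) : Prop where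
  total : u.col 0 false + u.col 0 true + (u.col 1 false + u.col 1 true) +
      (u.col 2 false + u.col 2 true) =
    v.col 0 false + v.col 0 true + (v.col 1 false + v.col 1 true) + (v.col 2 false + v.col 2 true)
  diff : ∀ i, u.col i true - u.col i false = v.col i true - v.col i false
  height : u 0 false true + u 0 true true + (u 1 false true + u 1 true true) +
      (u 2 false true + u 2 true true) =
    v 0 false true + v 0 true true + (v 1 false true + v 1 true true) +
      (v 2 false true + v 2 true true)

theorem SamePoint.symm {u v : PrismWeight} (h : SamePoint u v) : SamePoint v u :=
  ⟨h.total.symm, fun i => (h.diff i).symm, h.height.symm⟩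

/-- The symmetry of the prism that exchanges the two levels and also the source and the sink. -/
def PrismWeight.swap (u : PrismWeight) : PrismWeight :=
  fun i b l => u i (if i = 0 then !b else b) (!l)

theorem PrismWeight.swap_injective : Function.Injective PrismWeight.swap := by
  intro u v h
  funext i b l
  have := congrFun (congrFun (congrFun h i) (if i = 0 then !b else b)) (!l)
  by_cases hi : i = 0 <;> simpa [swap, hi] using this

theorem SamePoint.swap {u v : PrismWeight} (h : SamePoint u v) : SamePoint u.swap v.swap := by
  obtain ⟨h1, h2, h3⟩ := h
  have d0 := h2 0
  have d1 := h2 1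
  have d2 := h2 2
  simp only [PrismWeight.col] at h1 d0 d1 d2
  refine ⟨?_, ?_, ?_⟩
  · simp [PrismWeight.col, PrismWeight.swap]; linarith
  · intro i
    fin_cases i <;> simp [PrismWeight.col, PrismWeight.swap] <;> linarith
  · simp [PrismWeight.swap]; linarith

theorem IsUpper.swap {k : Fin 3} {u : PrismWeight} (h : IsUpper k u) : IsLower k u.swap := by
  refine ⟨by simpa [PrismWeight.swap] using h.sink, fun i hi b => ?_, fun i hi => ?_⟩
  · simpa [PrismWeight.swap, hi] using h.lower i hi b
  · by_cases h0 : i = 0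
    · simpa [PrismWeight.swap, h0] using (h0 ▸ h.axis i hi).symm
    · simpa [PrismWeight.swap, h0] using h.axis i hi

theorem IsMiddle.swap {e : Bool → Bool → Prop} {u : PrismWeight} (h : IsMiddle e u) :
    IsMiddle (fun b b' => ¬ e b b') u.swap := by
  refine ⟨by simpa [PrismWeight.swap] using h.sink, by simpa [PrismWeight.swap] using h.source,
    fun i hi => ?_, fun b b' he => ?_, fun b b' he => ?_⟩
  · simpa [PrismWeight.swap, hi, and_comm] using h.axis i hi
  · simpa [PrismWeight.swap] using (h.neg b b' he).symm
  · simpa [PrismWeight.swap] using (h.pos b b' (not_not.1 he)).symm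

theorem eq_of_sub_eq {x y x' y' : ℝ} (hx : 0 ≤ x) (hy : 0 ≤ y) (hx' : 0 ≤ x') (hy' : 0 ≤ y')
    (h : x = 0 ∨ y = 0) (h' : x' = 0 ∨ y' = 0) (hd : y - x = y' - x') : x = x' ∧ y = y' := by
  rcases h with h | h <;> rcases h' with h' | h' <;> constructor <;> linarith

/-- Uniqueness in the triangulation of an octahedron around its axis `k`. -/
theorem octahedron_unique {x y x' y' : Fin 3 → ℝ} (hx : ∀ i, 0 ≤ x i) (hy : ∀ i, 0 ≤ y i)
    (hx' : ∀ i, 0 ≤ x' i) (hy' : ∀ i, 0 ≤ y' i) (k : Fin 3) (h : ∀ i, i ≠ k → x i = 0 ∨ y i = 0)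
    (h' : ∀ i, i ≠ k → x' i = 0 ∨ y' i = 0) (hd : ∀ i, y i - x i = y' i - x' i)
    (hs : x 0 + y 0 + (x 1 + y 1) + (x 2 + y 2) = x' 0 + y' 0 + (x' 1 + y' 1) + (x' 2 + y' 2)) :
    x = x' ∧ y = y' := by
  have hne : ∀ i, i ≠ k → x i = x' i ∧ y i = y' i := fun i hi =>
    eq_of_sub_eq (hx i) (hy i) (hx' i) (hy' i) (h i hi) (h' i hi) (hd i)
  have hk : x k = x' k ∧ y k = y' k := by
    have hdk := hd k
    fin_cases k
    · have h1 := hne 1 (by decide)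
      have h2 := hne 2 (by decide)
      simp only [Fin.zero_eta] at hdk ⊢
      constructor <;> linarith
    · have h1 := hne 0 (by decide)
      have h2 := hne 2 (by decide)
      simp only [Fin.mk_one] at hdk ⊢
      constructor <;> linarith
    · have h1 := hne 0 (by decide)
      have h2 := hne 1 (by decide)
      simp only [Fin.reduceFinMk] at hdk ⊢
      constructor <;> linarith
  constructor <;> funext i <;> by_cases hi : i = k
  · rw [hi]; exact hk.1
  · exact (hne i hi).1
  · rw [hi]; exact hk.2
  · exact (hne i hi).2

theorem prismWeight_ext {u v : PrismWeight} (h0 : ∀ b l, u 0 b l = v 0 b l)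
    (h1 : ∀ b l, u 1 b l = v 1 b l) (h2 : ∀ b l, u 2 b l = v 2 b l) : u = v := by
  funext i b l
  fin_cases i
  exacts [h0 b l, h1 b l, h2 b l]

variable {u v : PrismWeight} {k k' : Fin 3} {e : Bool → Bool → Prop}

theorem IsLower.unique (hu0 : ∀ i b l, 0 ≤ u i b l) (hv0 : ∀ i b l, 0 ≤ v i b l)
    (h : SamePoint u v) (hu : IsLower k u) (hv : IsLower k v) : u = v := by
  obtain ⟨h1, h2, h3⟩ := h
  have hh : u 0 true true = v 0 true true := by
    simp only [hu.source, hv.source, hu.upper 1 (by decide), hu.upper 2 (by decide),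
      hv.upper 1 (by decide), hv.upper 2 (by decide)] at h3
    linarith
  have hl : ∀ i b, u i b true = v i b true := by
    intro i b
    by_cases hi : i = 0
    · subst hi
      cases b
      · rw [hu.source, hv.source]
      · exact hh
    · rw [hu.upper i hi, hv.upper i hi]
  simp only [PrismWeight.col, hl] at h1 h2
  have key := octahedron_unique (x := fun i => u i false false) (y := fun i => u i true false)
    (x' := fun i => v i false false) (y' := fun i => v i true false) (fun i => hu0 i _ _)
    (fun i => hu0 i _ _) (fun i => hv0 i _ _) (fun i => hv0 i _ _) k hu.axis hv.axis
    (fun i => by linarith [h2 i]) (by linarith)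
  funext i b l
  cases l
  · cases b
    · exact congrFun key.1 i
    · exact congrFun key.2 i
  · exact hl i b

theorem IsLower.unique_of_isMiddle (hu0 : ∀ i b l, 0 ≤ u i b l) (hv0 : ∀ i b l, 0 ≤ v i b l)
    (h : SamePoint u v) (hu : IsLower k u) (hv : IsMiddle e v) : u = v := by
  obtain ⟨h1, h2, h3⟩ := h
  have d0 := h2 0
  have d1 := h2 1
  have d2 := h2 2
  have a1 := hu.upper 1 (by decide)
  have a2 := hu.upper 2 (by decide)
  have n := fun i => (⟨hu0 i false false, hu0 i true false⟩ : _ ∧ _)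
  have n' := fun i => (⟨hv0 i false true, hv0 i true true⟩ : _ ∧ _)
  have m1 := n 0
  have m2 := n 1
  have m3 := n 2
  have m2' := n' 1
  have m3' := n' 2
  simp only [PrismWeight.col, hu.source, hv.source, hv.sink, a1, a2] at h1 h3 d0 d1 d2
  -- The weight of the sink in the middle part is at least the height in the lower part, with
  -- equality only on the common face.
  rcases hv.axis 1 (by decide) with z1 | z1 <;> rcases hv.axis 2 (by decide) with z2 | z2 <;>
    simp only [z1, z2] at h1 h3 d1 d2 m2' m3' <;>
    refine prismWeight_ext (fun b l => ?_) (fun b l => ?_) (fun b l => ?_) <;>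
    cases b <;> cases l <;>
    (try simp only [hu.source, hv.source, hv.sink, a1, a2, z1, z2]) <;> linarith

theorem IsLower.unique_of_isUpper (hu0 : ∀ i b l, 0 ≤ u i b l) (hv0 : ∀ i b l, 0 ≤ v i b l)
    (h : SamePoint u v) (hu : IsLower k u) (hv : IsUpper k' v) : u = v := by
  obtain ⟨h1, h2, h3⟩ := h
  have d0 := h2 0
  have d1 := h2 1
  have d2 := h2 2
  have a1 := hu.upper 1 (by decide)
  have a2 := hu.upper 2 (by decide)
  have b1 := hv.lower 1 (by decide)
  have b2 := hv.lower 2 (by decide)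
  have m1 := hu0 0 true false
  have m2 := hu0 1 false false
  have m3 := hu0 1 true false
  have m4 := hu0 2 false false
  have m5 := hu0 2 true false
  have m1' := hv0 0 false true
  have m2' := hv0 1 false true
  have m3' := hv0 1 true true
  have m4' := hv0 2 false true
  have m5' := hv0 2 true true
  simp only [PrismWeight.col, hu.source, hv.sink, a1, a2, b1, b2] at h1 h3 d0 d1 d2
  refine prismWeight_ext (fun b l => ?_) (fun b l => ?_) (fun b l => ?_) <;>
    cases b <;> cases l <;> (try simp only [hu.source, hv.sink, a1, a2, b1, b2]) <;> linarith

theorem IsMiddle.unique (hu0 : ∀ i b l, 0 ≤ u i b l) (hv0 : ∀ i b l, 0 ≤ v i b l)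
    (h : SamePoint u v) (hu : IsMiddle e u) (hv : IsMiddle e v) : u = v := by
  have hcol : ∀ {w : PrismWeight}, (∀ i b l, 0 ≤ w i b l) → ∀ i b, 0 ≤ w.col i b :=
    fun hw i b => add_nonneg (hw i b _) (hw i b _)
  have hax : ∀ {w : PrismWeight}, IsMiddle e w → ∀ i, i ≠ 0 →
      w.col i false = 0 ∨ w.col i true = 0 := fun hw i hi =>
    (hw.axis i hi).imp (fun h => by simp [PrismWeight.col, h]) fun h => by simp [PrismWeight.col, h]
  obtain ⟨c1, c2⟩ := octahedron_unique (x := fun i => u.col i false) (y := fun i => u.col i true)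
    (x' := fun i => v.col i false) (y' := fun i => v.col i true) (fun i => hcol hu0 i _)
    (fun i => hcol hu0 i _) (fun i => hcol hv0 i _) (fun i => hcol hv0 i _) 0 (hax hu) (hax hv)
    h.diff h.total
  have hc : ∀ i b, u.col i b = v.col i b := fun i b => by
    cases b
    · exact congrFun c1 i
    · exact congrFun c2 i
  have hz : ∀ i b, (∀ l, u i b l = 0) → ∀ l, v i b l = 0 := by
    intro i b hub l
    have h1 : v.col i b = 0 := by rw [← hc]; simp [PrismWeight.col, hub]
    unfold PrismWeight.col at h1
    cases l <;> linarith [hv0 i b false, hv0 i b true]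
  have hlive : ∀ i, i ≠ 0 → ∃ b, (∀ l, u i (!b) l = 0) ∧ ∀ l, v i (!b) l = 0 := fun i hi =>
    (hu.axis i hi).elim (fun h => ⟨true, h, hz i _ h⟩) fun h => ⟨false, h, hz i _ h⟩
  obtain ⟨b, hub, hvb⟩ := hlive 1 (by decide)
  obtain ⟨b', hub', hvb'⟩ := hlive 2 (by decide)
  have c0 := hc 0 false
  have c0' := hc 0 true
  have c1' := hc 1 b
  have c2' := hc 2 b'
  simp only [PrismWeight.col, hu.source, hv.source, hu.sink, hv.sink] at c0 c0' c1' c2'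
  have hh : u 1 b true + u 2 b' true = v 1 b true + v 2 b' true := by
    have h3 := h.height
    rw [hu.source, hv.source] at h3
    cases b <;> cases b' <;> simp only [Bool.not_true, Bool.not_false] at hub hvb hub' hvb' <;>
      simp only [hub, hvb, hub', hvb'] at h3 <;> linarith
  have key : (u 1 b true = v 1 b true ∧ u 2 b' false = v 2 b' false) ∨
      (u 2 b' true = v 2 b' true ∧ u 1 b false = v 1 b false) := by
    by_cases he : e b b'
    · exact .inl (eq_of_sub_eq (hu0 _ _ _) (hu0 _ _ _) (hv0 _ _ _) (hv0 _ _ _) (hu.pos b b' he)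
        (hv.pos b b' he) (by linarith))
    · exact .inr (eq_of_sub_eq (hu0 _ _ _) (hu0 _ _ _) (hv0 _ _ _) (hv0 _ _ _) (hu.neg b b' he)
        (hv.neg b b' he) (by linarith))
  have l1 : ∀ l, u 1 b l = v 1 b l := by
    intro l
    cases l <;> rcases key with ⟨h1, h2⟩ | ⟨h1, h2⟩ <;> linarith
  have l2 : ∀ l, u 2 b' l = v 2 b' l := by
    intro l
    cases l <;> rcases key with ⟨h1, h2⟩ | ⟨h1, h2⟩ <;> linarith
  have hb : ∀ a c : Bool, a = c ∨ a = !c := by decide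
  refine prismWeight_ext (fun a l => ?_) (fun a l => ?_) (fun a l => ?_)
  · cases a <;> cases l <;> (try simp only [hu.source, hv.source, hu.sink, hv.sink]) <;> linarith
  · rcases hb a b with rfl | rfl
    · exact l1 l
    · rw [hub, hvb]
  · rcases hb a b' with rfl | rfl
    · exact l2 l
    · rw [hub', hvb']

/-- Uniqueness in the triangulation of the prism over an octahedron. -/
theorem prism_unique (hu0 : ∀ i b l, 0 ≤ u i b l) (hv0 : ∀ i b l, 0 ≤ v i b l)
    (h : SamePoint u v) (hu : IsLower k u ∨ IsUpper k' u ∨ IsMiddle e u)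
    (hv : IsLower k v ∨ IsUpper k' v ∨ IsMiddle e v) : u = v := by
  have hs0 : ∀ {w : PrismWeight}, (∀ i b l, 0 ≤ w i b l) → ∀ i b l, 0 ≤ w.swap i b l :=
    fun hw i b l => hw _ _ _
  rcases hu with hu | hu | hu <;> rcases hv with hv | hv | hv
  · exact hu.unique hu0 hv0 h hv
  · exact hu.unique_of_isUpper hu0 hv0 h hv
  · exact hu.unique_of_isMiddle hu0 hv0 h hv
  · exact (hv.unique_of_isUpper hv0 hu0 h.symm hu).symm
  · exact PrismWeight.swap_injective (hu.swap.unique (hs0 hu0) (hs0 hv0) h.swap hv.swap)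
  · exact PrismWeight.swap_injective
      (hu.swap.unique_of_isMiddle (hs0 hu0) (hs0 hv0) h.swap hv.swap)
  · exact (hv.unique_of_isMiddle hv0 hu0 h.symm hu).symm
  · exact PrismWeight.swap_injective
      (hv.swap.unique_of_isMiddle (hs0 hv0) (hs0 hu0) h.symm.swap hu.swap).symm
  · exact hu.unique hu0 hv0 h hv

/-- Every point of the cone over an octahedron is represented in its triangulation around the axis
`k`: the slack that is left by the coordinates goes to both ends of this axis. -/
theorem octahedron_exists (k : Fin 3) {m : ℝ} {X : Fin 3 → ℝ}
    (hm : |X 0| + |X 1| + |X 2| ≤ m) : ∃ x y : Fin 3 → ℝ, (∀ i, 0 ≤ x i) ∧ (∀ i, 0 ≤ y i) ∧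
      (∀ i, i ≠ k → x i = 0 ∨ y i = 0) ∧ (∀ i, y i - x i = X i) ∧
      x 0 + y 0 + (x 1 + y 1) + (x 2 + y 2) = m := by
  set S : ℝ := (m - (|X 0| + |X 1| + |X 2|)) / 2 with hS
  have hS0 : 0 ≤ S := by rw [hS]; linarith
  have habs : ∀ i, (X i)⁻ + (X i)⁺ = |X i| := fun i => by rw [add_comm]; exact posPart_add_negPart _
  refine ⟨fun i => (X i)⁻ + if i = k then S else 0, fun i => (X i)⁺ + if i = k then S else 0,
    fun i => ?_, fun i => ?_, fun i hi => ?_, fun i => ?_, ?_⟩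
  · have := negPart_nonneg (X i)
    dsimp only
    split_ifs <;> linarith
  · have := posPart_nonneg (X i)
    dsimp only
    split_ifs <;> linarith
  · rcases le_total 0 (X i) with h | h
    · left; simp [hi, negPart_eq_zero.2 h]
    · right; simp [hi, posPart_eq_zero.2 h]
  · have := posPart_sub_negPart (X i)
    linarith
  · have h0 := habs 0
    have h1 := habs 1
    have h2 := habs 2
    fin_cases k <;> simp <;> linarith

/-- Existence in the triangulation of the prism over an octahedron. -/
theorem prism_exists (k k' : Fin 3) (e : Bool → Bool → Prop) {m h : ℝ} {X : Fin 3 → ℝ}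
    (hm : |X 0| + |X 1| + |X 2| ≤ m) (h0 : 0 ≤ h) (h1 : h ≤ m) : ∃ u : PrismWeight,
      (∀ i b l, 0 ≤ u i b l) ∧ (IsLower k u ∨ IsUpper k' u ∨ IsMiddle e u) ∧
      (∀ i, u.col i true - u.col i false = X i) ∧
      u.col 0 false + u.col 0 true + (u.col 1 false + u.col 1 true) +
        (u.col 2 false + u.col 2 true) = m ∧
      u 0 false true + u 0 true true + (u 1 false true + u 1 true true) +
        (u 2 false true + u 2 true true) = h := by
  have hX0 := neg_abs_le (X 0)
  have hX0' := le_abs_self (X 0)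
  -- Compare the height with the weights of the sink and the source in the triangulation of the
  -- octahedron around the axis `0`.
  by_cases hlow : 2 * h ≤ m + X 0 - |X 1| - |X 2|
  · have hm' : |(![X 0 - h, X 1, X 2] : Fin 3 → ℝ) 0| + |(![X 0 - h, X 1, X 2] : Fin 3 → ℝ) 1| +
        |(![X 0 - h, X 1, X 2] : Fin 3 → ℝ) 2| ≤ m - h := by
      have : |X 0 - h| ≤ m - h - |X 1| - |X 2| := abs_le.2 ⟨by linarith, by linarith⟩
      simp only [Matrix.cons_val]
      linarith
    obtain ⟨x, y, hx, hy, hk, hd, hs⟩ := octahedron_exists k hm'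
    have d0 := hd 0
    have d1 := hd 1
    have d2 := hd 2
    simp only [Matrix.cons_val] at d0 d1 d2
    refine ⟨fun i b l => if l then (if i = 0 ∧ b then h else 0) else if b then y i else x i,
      fun i b l => ?_, .inl ⟨by simp, fun i hi b => by simp [hi], fun i hi => by simpa using hk i hi⟩,
      fun i => ?_, ?_, ?_⟩
    · have := hx i
      have := hy i
      dsimp only
      split_ifs <;> first | assumption | exact le_rfl
    · fin_cases i <;> simp [PrismWeight.col] <;> linarith
    · simp [PrismWeight.col]; linarith
    · simp
  by_cases hup : 2 * (m - h) ≤ m - X 0 - |X 1| - |X 2|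
  · have hm' : |(![X 0 + (m - h), X 1, X 2] : Fin 3 → ℝ) 0| +
        |(![X 0 + (m - h), X 1, X 2] : Fin 3 → ℝ) 1| +
        |(![X 0 + (m - h), X 1, X 2] : Fin 3 → ℝ) 2| ≤ h := by
      have : |X 0 + (m - h)| ≤ h - |X 1| - |X 2| := abs_le.2 ⟨by linarith, by linarith⟩
      simp only [Matrix.cons_val]
      linarith
    obtain ⟨x, y, hx, hy, hk, hd, hs⟩ := octahedron_exists k' hm'
    have d0 := hd 0
    have d1 := hd 1
    have d2 := hd 2
    simp only [Matrix.cons_val] at d0 d1 d2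
    refine ⟨fun i b l => if l then (if b then y i else x i) else if i = 0 ∧ !b then m - h else 0,
      fun i b l => ?_, .inr (.inl ⟨by simp, fun i hi b => by simp [hi],
        fun i hi => by simpa using hk i hi⟩), fun i => ?_, ?_, ?_⟩
    · have := hx i
      have := hy i
      dsimp only
      split_ifs <;> first | assumption | linarith
    · fin_cases i <;> simp [PrismWeight.col] <;> linarith
    · simp [PrismWeight.col]; linarith
    · simp; linarith
  · push Not at hlow hup
    -- The weights of the sink, of the source, and of the live ends of the other two axes.
    set t : ℝ := (m + X 0 - |X 1| - |X 2|) / 2 with ht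
    set s : ℝ := (m - X 0 - |X 1| - |X 2|) / 2 with hs
    set g : ℝ := h - t with hg
    have ht0 : 0 ≤ t := by rw [ht]; linarith
    have hs0 : 0 ≤ s := by rw [hs]; linarith
    have hg0 : 0 ≤ g := by rw [hg, ht]; linarith
    have hg1 : g ≤ |X 1| + |X 2| := by rw [hg, ht]; linarith
    have hlive : ∀ x : ℝ, ∃ b : Bool, (b = true → x = |x|) ∧ (b = false → x = -|x|) := by
      intro x
      rcases le_total 0 x with hx | hx
      · exact ⟨true, by simp [abs_of_nonneg hx], by simp⟩
      · exact ⟨false, by simp, by simp [abs_of_nonpos hx]⟩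
    obtain ⟨b₁, hb₁⟩ := hlive (X 1)
    obtain ⟨b₂, hb₂⟩ := hlive (X 2)
    have n1 := abs_nonneg (X 1)
    have n2 := abs_nonneg (X 2)
    -- The remaining height is distributed along a monotone path in the square over the edge.
    obtain ⟨g₁, g₂, hg₁, hg₁', hg₂, hg₂', hgg, hp, hn⟩ : ∃ g₁ g₂ : ℝ, 0 ≤ g₁ ∧ g₁ ≤ |X 1| ∧
        0 ≤ g₂ ∧ g₂ ≤ |X 2| ∧ g₁ + g₂ = g ∧ (e b₁ b₂ → g₁ = 0 ∨ |X 2| - g₂ = 0) ∧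
        (¬ e b₁ b₂ → g₂ = 0 ∨ |X 1| - g₁ = 0) := by
      by_cases he : e b₁ b₂
      · rcases le_total g |X 2| with hle | hle
        · exact ⟨0, g, le_rfl, n1, hg0, hle, by ring, fun _ => .inl rfl, fun h => absurd he h⟩
        · exact ⟨g - |X 2|, |X 2|, by linarith, by linarith, n2, le_rfl, by ring,
            fun _ => .inr (by ring), fun h => absurd he h⟩
      · rcases le_total g |X 1| with hle | hle
        · exact ⟨g, 0, hg0, hle, le_rfl, n2, by ring, fun h => absurd h he, fun _ => .inl rfl⟩
        · exact ⟨|X 1|, g - |X 1|, n1, le_rfl, by linarith, by linarith, by ring,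
            fun h => absurd h he, fun _ => .inr (by ring)⟩
    refine ⟨![fun b l => if b then (if l then t else 0) else if l then 0 else s,
      fun b l => if b = b₁ then (if l then g₁ else |X 1| - g₁) else 0,
      fun b l => if b = b₂ then (if l then g₂ else |X 2| - g₂) else 0],
      fun i b l => ?_, .inr (.inr ⟨by simp, by simp, fun i hi => ?_, fun b b' hbb => ?_,
        fun b b' hbb => ?_⟩), fun i => ?_, ?_, ?_⟩
    · fin_cases i <;> simp <;> split_ifs <;> linarith
    · fin_cases i
      · exact absurd rfl hi
      · cases b₁ <;> simp
      · cases b₂ <;> simp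
    · by_cases h1 : b = b₁
      · by_cases h2 : b' = b₂
        · subst h1 h2; simpa using hp hbb
        · right; simp [h2]
      · left; simp [h1]
    · by_cases h1 : b = b₁
      · by_cases h2 : b' = b₂
        · subst h1 h2; simpa using hn hbb
        · left; simp [h2]
      · right; simp [h1]
    · fin_cases i
      · simp [PrismWeight.col]; rw [ht, hs]; ring
      · cases b₁ <;> simp [PrismWeight.col] at hb₁ ⊢ <;> linarith
      · cases b₂ <;> simp [PrismWeight.col] at hb₂ ⊢ <;> linarith
    · cases b₁ <;> cases b₂ <;> simp [PrismWeight.col] <;> rw [ht, hs] <;> ring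
    · cases b₁ <;> cases b₂ <;> simp <;> linarith

end OctahedralPrism

/-! ### The cells of the triangulations -/

/-- Orientations of the 24-cell's edges: `some _` are the symplectic ones, `none` is linear. -/
abbrev OrientIndex := Option (Fin 3 × Bool × Bool)

/-- The index of the source of a facet in an orientation. -/
noncomputable def sourceIndex (o : OrientIndex) (F : Fin 24) : Fin 3 × Bool :=
  (exists_source o F).choose

/-- The vertices of a facet in the indexing adapted to an orientation: `(0, false)` is the source
and `(0, true)` is the sink. -/
noncomputable def facetVtx (o : OrientIndex) (F : Fin 24) (i : Fin 3) (b : Bool) : Fin 24 :=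
  corner F (sourceIndex o F) i b

section FacetVtx

variable {o : OrientIndex} {F F' : Fin 24} {i j : Fin 3} {b b' : Bool}

theorem dirEdge_source (hi : i ≠ 0) (b : Bool) :
    DirEdge o (facetVtx o F 0 false) (facetVtx o F i b) :=
  ((exists_source o F).choose_spec i b hi).1

theorem dirEdge_sink (hi : i ≠ 0) (b : Bool) :
    DirEdge o (facetVtx o F i b) (facetVtx o F 0 true) :=
  ((exists_source o F).choose_spec i b hi).2

theorem facetVtx_inj : facetVtx o F i b = facetVtx o F j b' ↔ i = j ∧ b = b' :=
  ⟨corner_injective _ _, by rintro ⟨rfl, rfl⟩; rfl⟩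

theorem cellAdj_facetVtx : CellAdj (facetVtx o F i b) (facetVtx o F j b') ↔ i ≠ j := by
  refine ⟨?_, fun h => dotZ_corner_of_ne _ _ h _ _⟩
  rintro h rfl
  have h4 := dotZ_vertexZ_self (facetVtx o F i b)
  have h0 := dotZ_corner_antipode F (sourceIndex o F) i b
  unfold CellAdj facetVtx at h
  unfold facetVtx at h4
  cases b <;> cases b' <;> simp only [Bool.not_true, Bool.not_false] at h0 <;> omega

theorem not_dirEdge_of_sink : ¬ DirEdge o (facetVtx o F 0 true) (facetVtx o F j b') := fun h =>
  h.not_directed (dirEdge_sink (cellAdj_facetVtx.1 h.1).symm b')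

theorem not_dirEdge_of_source : ¬ DirEdge o (facetVtx o F i b) (facetVtx o F 0 false) := fun h =>
  h.not_directed (dirEdge_source (cellAdj_facetVtx.1 h.1) b)

theorem inFacet_facetVtx : InFacet (facetVtx o F i b) F := inFacet_corner _ _ _ _

theorem InFacet.exists_facetVtx {x : Fin 24} (h : InFacet x F) (o : OrientIndex) :
    ∃ i b, x = facetVtx o F i b := h.exists_corner _

theorem sum_facet {f : Fin 24 → ℝ} (hf : ∀ x, ¬ InFacet x F → f x = 0) :
    ∑ x, f x = f (facetVtx o F 0 false) + f (facetVtx o F 0 true) +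
      (f (facetVtx o F 1 false) + f (facetVtx o F 1 true)) +
      (f (facetVtx o F 2 false) + f (facetVtx o F 2 true)) := by
  have hinj : Function.Injective fun a : Fin 3 × Bool => facetVtx o F a.1 a.2 := fun a c h => by
    have := facetVtx_inj.1 h
    exact Prod.ext this.1 this.2
  rw [← Fintype.sum_of_injective _ hinj (fun a => f (facetVtx o F a.1 a.2)) f
    (fun x hx => hf x fun h => hx (by
      obtain ⟨i, b, rfl⟩ := h.exists_facetVtx o
      exact ⟨(i, b), rfl⟩)) fun _ => rfl, Fintype.sum_prod_type, Fin.sum_univ_three]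
  simp only [Fintype.sum_bool]
  ring

/-- The direction of an axis of a facet, from its end `false` to its end `true`. -/
noncomputable def axisR (o : OrientIndex) (F : Fin 24) (i : Fin 3) : Fin 4 → ℝ :=
  vertexR (facetVtx o F i true) - vertexR (facetVtx o F i false)

theorem facetVtx_dot_axisR (b : Bool) : vertexR (facetVtx o F j b) ⬝ᵥ axisR o F i =
    if j = i then (if b then 4 else -4) else 0 := by
  have hadj : ∀ b', j ≠ i → vertexR (facetVtx o F j b) ⬝ᵥ vertexR (facetVtx o F i b') = 2 :=
    fun b' h => (cellAdj_facetVtx.2 h).dot_eq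
  have hant : vertexR (facetVtx o F j b) ⬝ᵥ vertexR (facetVtx o F j !b) = 0 := by
    rw [vertexR_dot_vertexR]
    exact_mod_cast dotZ_corner_antipode F (sourceIndex o F) j b
  have hself := vertexR_dot_self (facetVtx o F j b)
  rw [axisR, dotProduct_sub]
  split_ifs with h hb
  · subst h hb
    simp only [Bool.not_true] at hant
    rw [hant, hself]; norm_num
  · subst h
    obtain rfl : b = false := by simpa using hb
    simp only [Bool.not_false] at hant
    rw [hant, hself]; norm_num
  · rw [hadj _ h, hadj _ h]; norm_num

theorem dot_centerR_of_inFacet {x : Fin 24} (h : InFacet x F) : vertexR x ⬝ᵥ centerR F = 2 := by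
  rw [vertexR_dot_centerR, show dotZ _ _ = 2 from h]; norm_num

theorem dot_centerR_le (x F : Fin 24) : vertexR x ⬝ᵥ centerR F ≤ 2 := by
  rw [vertexR_dot_centerR]; exact_mod_cast dotZ_vertexZ_centerZ_le x F

theorem inFacet_of_dot_centerR {x : Fin 24} (h : vertexR x ⬝ᵥ centerR F = 2) : InFacet x F := by
  rw [vertexR_dot_centerR] at h
  exact_mod_cast h

theorem vertexR_facetVtx_add :
    vertexR (facetVtx o F i false) + vertexR (facetVtx o F i true) = (2 : ℝ) • centerR F := by
  funext k
  have := vertexZ_corner_add F (sourceIndex o F) i k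
  simp only [Pi.add_apply, Pi.smul_apply, smul_eq_mul, vertexR, centerR, facetVtx]
  exact_mod_cast this

/-- Coordinates of a vector in the orthogonal basis given by the centre and the axes of a facet. -/
theorem facet_expansion (o : OrientIndex) (F : Fin 24) (p : Fin 4 → ℝ) :
    p = (p ⬝ᵥ centerR F / 2) • centerR F + ∑ i, (p ⬝ᵥ axisR o F i / 8) • axisR o F i := by
  funext k
  have key : ∀ k', 4 * centerR F k * centerR F k' + ∑ i, axisR o F i k * axisR o F i k' =
      if k = k' then 8 else 0 := by
    intro k'
    have := corner_resolution F (sourceIndex o F) k k'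
    simp only [centerR, axisR, Pi.sub_apply, vertexR, facetVtx]
    exact_mod_cast this
  have h : ∑ k', p k' * (4 * centerR F k * centerR F k' + ∑ i, axisR o F i k * axisR o F i k') =
      8 * p k := by
    simp only [key, mul_ite, mul_zero, Finset.sum_ite_eq, Finset.mem_univ, if_true]
    ring
  simp only [Fin.sum_univ_three, Fin.sum_univ_four] at h
  simp only [Pi.add_apply, Pi.smul_apply, smul_eq_mul, dotProduct,
    Fin.sum_univ_three, Fin.sum_univ_four]
  linarith

end FacetVtx

section Cells

/-- A choice of a diagonal (an axis) in the lower and in the upper copy of each facet. -/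
abbrev Diagonals := Bool × Fin 24 → Fin 3

/-- The simplices of the triangulation given by the orientation `o` and the diagonals `D` that lie
over the cone of the facet `F`. They avoid a lower apex together with an upper vertex, and the
diagonals opposite to `o` in the squares over the edges. If they contain two antipodes at the
same level, these span the chosen diagonal, and the only vertex at the other level is the sink (for
the lower level) or the source (for the upper level). They contain no antipodes at distinct
levels but the lower source and the upper sink. -/
structure IsCell (o : OrientIndex) (D : Diagonals) (F : Fin 24) (σ : Finset Label) : Prop where
  inFacet : ∀ {x l}, (some x, l) ∈ σ → InFacet x F
  apex : (none, false) ∈ σ → ∀ x, (some x, true) ∉ σ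
  edge : ∀ {x y}, DirEdge o x y → (some x, true) ∈ σ → (some y, false) ∉ σ
  antipodes : ∀ {i l}, (some (facetVtx o F i false), l) ∈ σ → (some (facetVtx o F i true), l) ∈ σ →
    D (l, F) = i ∧ ∀ y, (some y, !l) ∈ σ → y = facetVtx o F 0 (!l)
  mixed : ∀ {i b}, (some (facetVtx o F i b), false) ∈ σ → (some (facetVtx o F i !b), true) ∈ σ →
    i = 0 ∧ b = false

/-- The simplices of the triangulation given by an orientation and diagonals. -/
def cells (o : OrientIndex) (D : Diagonals) : Set (Finset Label) := {σ | ∃ F, IsCell o D F σ}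

variable {o : OrientIndex} {D : Diagonals} {F F' : Fin 24} {σ τ : Finset Label}

theorem IsCell.mono (h : IsCell o D F τ) (hs : σ ⊆ τ) : IsCell o D F σ where
  inFacet hx := h.inFacet (hs hx)
  apex ha x hx := h.apex (hs ha) x (hs hx)
  edge hxy hx hy := h.edge hxy (hs hx) (hs hy)
  antipodes h1 h2 := ⟨(h.antipodes (hs h1) (hs h2)).1,
    fun y hy => (h.antipodes (hs h1) (hs h2)).2 y (hs hy)⟩
  mixed h1 h2 := h.mixed (hs h1) (hs h2)

theorem isLowerSet_cells (o : OrientIndex) (D : Diagonals) : IsLowerSet (cells o D) :=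
  fun _ _ hs ⟨F, h⟩ => ⟨F, h.mono hs⟩

theorem eq_of_inFacet_facetVtx {i : Fin 3} (h : InFacet (facetVtx o F i false) F')
    (h' : InFacet (facetVtx o F i true) F') : F' = F := eq_of_inFacet_antipodes h h'

/-- A cell over `F'` all of whose vertices belong to `F` is a cell over `F`: distinct facets have no
antipodes in common. -/
theorem IsCell.change_facet (h : IsCell o D F' σ) (hF : ∀ {x l}, (some x, l) ∈ σ → InFacet x F) :
    IsCell o D F σ := by
  by_cases hFF : F' = F
  · exact hFF ▸ h
  have hno : ∀ {i l l'}, (some (facetVtx o F i false), l) ∈ σ →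
      (some (facetVtx o F i true), l') ∈ σ → False := fun h1 h2 =>
    hFF (eq_of_inFacet_facetVtx (h.inFacet h1) (h.inFacet h2))
  exact ⟨hF, h.apex, h.edge, fun h1 h2 => (hno h1 h2).elim, fun {i b} h1 h2 => by
    cases b
    · exact (hno h1 h2).elim
    · exact (hno h2 h1).elim⟩

/-- The weights of the vertices of the prism over a facet. -/
noncomputable def prismWeight (o : OrientIndex) (F : Fin 24) (w : Label → ℝ) : PrismWeight :=
  fun i b l => w (some (facetVtx o F i b), l)

/-- The direction of the equatorial edges of a facet. -/
def Equator (o : OrientIndex) (F : Fin 24) (b b' : Bool) : Prop :=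
  DirEdge o (facetVtx o F 1 b) (facetVtx o F 2 b')

theorem IsCell.prismWeight_type (h : IsCell o D F σ) {w : Label → ℝ} (hw : ∀ i, w i ≠ 0 → i ∈ σ) :
    IsLower (D (false, F)) (prismWeight o F w) ∨ IsUpper (D (true, F)) (prismWeight o F w) ∨
      IsMiddle (Equator o F) (prismWeight o F w) := by
  set u := prismWeight o F w
  have hu : ∀ {i b l}, u i b l ≠ 0 → (some (facetVtx o F i b), l) ∈ σ := fun h => hw _ h
  by_cases hA : ∃ i, u i false false ≠ 0 ∧ u i true false ≠ 0
  · obtain ⟨i, h1, h2⟩ := hA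
    have hup : ∀ j b, u j b true ≠ 0 → j = 0 ∧ b = true := fun j b hj =>
      facetVtx_inj.1 ((h.antipodes (hu h1) (hu h2)).2 _ (hu hj))
    refine .inl ⟨?_, fun j hj b => ?_, fun j hj => ?_⟩
    · by_contra h0
      simpa using hup _ _ h0
    · by_contra h0
      exact hj (hup _ _ h0).1
    · by_contra! h0
      exact hj (h.antipodes (hu h0.1) (hu h0.2)).1.symm
  by_cases hB : ∃ i, u i false true ≠ 0 ∧ u i true true ≠ 0
  · obtain ⟨i, h1, h2⟩ := hB
    have hlow : ∀ j b, u j b false ≠ 0 → j = 0 ∧ b = false := fun j b hj =>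
      facetVtx_inj.1 ((h.antipodes (hu h1) (hu h2)).2 _ (hu hj))
    refine .inr (.inl ⟨?_, fun j hj b => ?_, fun j hj => ?_⟩)
    · by_contra h0
      simpa using hlow _ _ h0
    · by_contra h0
      exact hj (hlow _ _ h0).1
    · by_contra! h0
      exact hj (h.antipodes (hu h0.1) (hu h0.2)).1.symm
  push Not at hA hB
  have hmixed : ∀ {i b}, u i b false ≠ 0 → u i (!b) true ≠ 0 → i = 0 ∧ b = false :=
    fun h1 h2 => h.mixed (hu h1) (hu h2)
  by_cases hs : u 0 false true = 0
  · by_cases ht : u 0 true false = 0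
    · refine .inr (.inr ⟨hs, ht, fun i hi => ?_, fun b b' he => ?_, fun b b' he => ?_⟩)
      · by_contra! h0
        obtain ⟨⟨l, hl⟩, l', hl'⟩ := h0
        cases l <;> cases l'
        · exact hl' (hA i hl)
        · exact hi (hmixed hl hl').1
        · exact hi (hmixed (b := true) hl' hl).1
        · exact hl' (hB i hl)
      · by_contra! h0
        exact h.edge he (hu h0.1) (hu h0.2)
      · by_contra! h0
        have hadj : CellAdj (facetVtx o F 1 b) (facetVtx o F 2 b') := cellAdj_facetVtx.2 (by decide)
        have he' := (hadj.directed_or o).resolve_left he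
        exact h.edge he' (hu h0.1) (hu h0.2)
    · refine .inl ⟨hs, fun i hi b => ?_, fun i _ => or_iff_not_imp_left.2 (hA i)⟩
      by_contra h0
      exact h.edge (dirEdge_sink hi b) (hu h0) (hu ht)
  · refine .inr (.inl ⟨?_, fun i hi b => ?_, fun i _ => or_iff_not_imp_left.2 (hB i)⟩)
    · by_contra h0
      simpa using hmixed (b := true) h0 hs
    · by_contra h0
      exact h.edge (dirEdge_source hi b) (hu hs) (hu h0)

/-! ### Uniqueness of the representation -/

variable {α β : ℝ}

/-- The coordinates of a convex combination supported over a facet. -/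
theorem sum_smul_location_coordinates {w : Label → ℝ}
    (hF : ∀ x l, ¬ InFacet x F → w (some x, l) = 0) :
    (∑ i, w i • location α β i).1 ⬝ᵥ centerR F = 2 * ∑ x, columnWeight w x ∧
    (∀ i, (∑ i, w i • location α β i).1 ⬝ᵥ axisR o F i =
      4 * ((prismWeight o F w).col i true - (prismWeight o F w).col i false)) ∧
    ∑ x, columnWeight w x = (prismWeight o F w).col 0 false + (prismWeight o F w).col 0 true +
      ((prismWeight o F w).col 1 false + (prismWeight o F w).col 1 true) +
      ((prismWeight o F w).col 2 false + (prismWeight o F w).col 2 true) ∧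
    ∑ x, w (some x, true) =
      prismWeight o F w 0 false true + prismWeight o F w 0 true true +
      (prismWeight o F w 1 false true + prismWeight o F w 1 true true) +
      (prismWeight o F w 2 false true + prismWeight o F w 2 true true) := by
  have hc : ∀ x, ¬ InFacet x F → columnWeight w x = 0 := fun x hx => by
    simp [columnWeight, hF x _ hx]
  refine ⟨?_, fun i => ?_, ?_, ?_⟩
  · rw [sum_smul_location_fst_dot, Finset.mul_sum]
    refine Finset.sum_congr rfl fun x _ => ?_
    by_cases hx : InFacet x F
    · rw [dot_centerR_of_inFacet hx, mul_comm]
    · rw [hc x hx]; ring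
  · rw [sum_smul_location_fst_dot, sum_facet (o := o) (F := F)
      (fun x hx => by rw [hc x hx, zero_mul])]
    simp only [facetVtx_dot_axisR]
    fin_cases i <;> simp [PrismWeight.col, prismWeight, columnWeight] <;> ring
  · exact sum_facet hc
  · exact sum_facet fun x hx => hF x _ hx

theorem IsCell.unique_of_facet (h : α < β) (hσ : IsCell o D F σ) (hτ : IsCell o D F τ)
    {w w' : Label → ℝ} (hw : ∀ i, 0 ≤ w i) (hw' : ∀ i, 0 ≤ w' i) (hwσ : ∀ i, w i ≠ 0 → i ∈ σ)
    (hwτ : ∀ i, w' i ≠ 0 → i ∈ τ) (h1 : ∑ i, w i = 1) (h1' : ∑ i, w' i = 1)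
    (heq : ∑ i, w i • location α β i = ∑ i, w' i • location α β i) : w = w' := by
  have hF : ∀ {w : Label → ℝ} {σ}, IsCell o D F σ → (∀ i, w i ≠ 0 → i ∈ σ) →
      ∀ x l, ¬ InFacet x F → w (some x, l) = 0 := fun hσ hwσ x l hx => by
    by_contra h0
    exact hx (hσ.inFacet (hwσ _ h0))
  have hapex : ∀ {w : Label → ℝ} {σ}, IsCell o D F σ → (∀ i, w i ≠ 0 → i ∈ σ) →
      w (none, false) = 0 ∨ ∑ x, w (some x, true) = 0 := fun hσ hwσ => by
    by_contra! h0
    obtain ⟨x, -, hx⟩ := Finset.exists_ne_zero_of_sum_ne_zero h0.2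
    exact hσ.apex (hwσ _ h0.1) x (hwσ _ hx)
  obtain ⟨a1, a2, a3, a4⟩ := sum_smul_location_coordinates (o := o) (α := α) (β := β) (hF hσ hwσ)
  obtain ⟨b1, b2, b3, b4⟩ := sum_smul_location_coordinates (o := o) (α := α) (β := β) (hF hτ hwτ)
  have hm : ∑ x, columnWeight w x = ∑ x, columnWeight w' x := by rw [heq, b1] at a1; linarith
  have hs := congrArg Prod.snd heq
  rw [sum_smul_location_snd, sum_smul_location_snd] at hs
  rw [sum_weights] at h1 h1'
  -- The height determines the positive and the negative part of the upper weight minus a multiple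
  -- of the weight of the lower apex.
  have hba : 0 < β - α := sub_pos.2 h
  have hnn : ∀ {w : Label → ℝ}, (∀ i, 0 ≤ w i) → 0 ≤ ∑ x, w (some x, true) :=
    fun hw => Finset.sum_nonneg fun _ _ => hw _
  obtain ⟨e0, eH⟩ := eq_of_sub_eq (mul_nonneg hba.le (hw (none, false))) (hnn hw)
    (mul_nonneg hba.le (hw' (none, false))) (hnn hw')
    ((hapex hσ hwσ).imp_left fun h => by rw [h, mul_zero])
    ((hapex hτ hwτ).imp_left fun h => by rw [h, mul_zero])
    (by
      have e : w (none, true) = w' (none, false) + w' (none, true) - w (none, false) := by linarith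
      rw [e] at hs
      linarith)
  have e0' := mul_left_cancel₀ hba.ne' e0
  have key := prism_unique (u := prismWeight o F w) (v := prismWeight o F w') (fun i b l => hw _)
    (fun i b l => hw' _)
    ⟨by rw [← a3, ← b3, hm], fun i => by
      have := a2 i
      rw [heq, b2 i] at this
      linarith, by rw [← a4, ← b4, eH]⟩ (hσ.prismWeight_type hwσ) (hτ.prismWeight_type hwτ)
  funext ⟨x, l⟩
  cases x with
  | none => cases l <;> linarith
  | some x =>
    by_cases hx : InFacet x F
    · obtain ⟨i, b, rfl⟩ := hx.exists_facetVtx o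
      exact congrFun (congrFun (congrFun key i) b) l
    · rw [hF hσ hwσ x l hx, hF hτ hwτ x l hx]

theorem uniqueWeights_cells (h : α < β) (o : OrientIndex) (D : Diagonals) :
    UniqueWeights (locate h) (cells o D) := by
  rintro σ ⟨F, hσ⟩ τ ⟨F', hτ⟩ w w' hw hw' hwσ hwτ h1 h1' heq
  change ∑ i, w i • location α β i = ∑ i, w' i • location α β i at heq
  have hF : ∀ {w : Label → ℝ} {σ F}, IsCell o D F σ → (∀ i, w i ≠ 0 → i ∈ σ) →
      ∀ x l, ¬ InFacet x F → w (some x, l) = 0 := fun hσ hwσ x l hx => by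
    by_contra h0
    exact hx (hσ.inFacet (hwσ _ h0))
  have a1 := (sum_smul_location_coordinates (o := o) (α := α) (β := β) (hF hσ hwσ)).1
  have b1 := (sum_smul_location_coordinates (o := o) (α := α) (β := β) (hF hτ hwτ)).1
  have hle : ∀ {w : Label → ℝ} (F : Fin 24), (∀ i, 0 ≤ w i) →
      (∑ i, w i • location α β i).1 ⬝ᵥ centerR F ≤ 2 * ∑ x, columnWeight w x := by
    intro w F hw
    rw [sum_smul_location_fst_dot, Finset.mul_sum]
    refine Finset.sum_le_sum fun x _ => ?_
    have := mul_le_mul_of_nonneg_left (dot_centerR_le x F) (columnWeight_nonneg hw x)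
    linarith
  have h2 := hle F hw'
  have h3 := hle F' hw
  rw [← heq] at h2
  rw [heq] at h3
  have h4 : ∑ x, columnWeight w' x * (2 - vertexR x ⬝ᵥ centerR F) = 0 := by
    simp only [mul_sub, Finset.sum_sub_distrib, ← Finset.sum_mul]
    rw [← sum_smul_location_fst_dot (α := α) (β := β), ← heq]
    linarith
  have h5 := (Finset.sum_eq_zero_iff_of_nonneg fun x _ =>
    mul_nonneg (columnWeight_nonneg hw' x) (sub_nonneg.2 (dot_centerR_le x F))).1 h4
  have hsupp : ∀ x l, w' (some x, l) ≠ 0 → InFacet x F := by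
    intro x l hx
    refine inFacet_of_dot_centerR ?_
    have hc : columnWeight w' x ≠ 0 := fun h0 => hx (by
      unfold columnWeight at h0
      cases l <;> linarith [hw' (some x, false), hw' (some x, true)])
    have := (mul_eq_zero.1 (h5 x (Finset.mem_univ x))).resolve_left hc
    linarith
  have hτ' : IsCell o D F (Finset.univ.filter fun i => w' i ≠ 0) :=
    (hτ.mono fun i hi => hwτ i (Finset.mem_filter.1 hi).2).change_facet
      fun {x l} hx => hsupp x l (Finset.mem_filter.1 hx).2
  exact hσ.unique_of_facet h hτ' hw hw' hwσ (fun i hi => by simpa using hi) h1 h1' heq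

end Cells

/-! ### The cells cover the polytope -/

section Cover

variable {o : OrientIndex} {D : Diagonals} {F : Fin 24} {α β : ℝ}

theorem exists_centerZ_eq_corner (F : Fin 24) (s : Fin 3 × Bool) (ε : Fin 3 → Bool) :
    ∃ F', ∀ k, 4 * centerZ F' k = 2 * centerZ F k +
      ∑ i, (vertexZ (corner F s i (ε i)) k - vertexZ (corner F s i !(ε i)) k) := by
  set ε' : Fin 3 → Bool := fun i => xor (ε (i - s.1)) s.2 with hε
  obtain ⟨F', hF'⟩ := exists_centerZ_eq F (ε' 0) (ε' 1) (ε' 2)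
  refine ⟨F', fun k => ?_⟩
  rw [hF' k, Finset.sum_congr rfl (g := fun i => (fun j => vertexZ (facetVertex F j (ε' j)) k -
      vertexZ (facetVertex F j !(ε' j)) k) (Equiv.addRight s.1 i))
      (fun i _ => by simp [corner, hε]), Equiv.sum_comp (Equiv.addRight s.1)
      (fun j => vertexZ (facetVertex F j (ε' j)) k - vertexZ (facetVertex F j !(ε' j)) k),
    Fin.sum_univ_three]
  ring

/-- The cones over the facets cover the space: a vector lies in the cone over the facet whose centre
has the largest inner product with it. -/
theorem exists_facet_cone (o : OrientIndex) (p : Fin 4 → ℝ) : ∃ F,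
    |p ⬝ᵥ axisR o F 0 / 4| + |p ⬝ᵥ axisR o F 1 / 4| + |p ⬝ᵥ axisR o F 2 / 4| ≤
      p ⬝ᵥ centerR F / 2 := by
  obtain ⟨F, hF⟩ := Finite.exists_max fun F => p ⬝ᵥ centerR F
  refine ⟨F, ?_⟩
  have hsign : ∀ x : ℝ, ∃ b : Bool, |x / 4| = (if b then 1 else -1) * (x / 4) := by
    intro x
    rcases le_total 0 (x / 4) with hx | hx
    · exact ⟨true, by simp [abs_of_nonneg hx]⟩
    · exact ⟨false, by simp [abs_of_nonpos hx]⟩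
  choose ε hε using fun i => hsign (p ⬝ᵥ axisR o F i)
  obtain ⟨F', hF'⟩ := exists_centerZ_eq_corner F (sourceIndex o F) ε
  have hvec : (4 : ℝ) • centerR F' = (2 : ℝ) • centerR F +
      ∑ i, (if ε i then 1 else -1 : ℝ) • axisR o F i := by
    funext k
    have := hF' k
    simp only [Fin.sum_univ_three] at this
    simp only [Pi.smul_apply, Pi.add_apply, smul_eq_mul, Fin.sum_univ_three, centerR, axisR,
      Pi.sub_apply, vertexR, facetVtx]
    have h2 : (4 * centerZ F' k : ℝ) = 2 * centerZ F k +
      (vertexZ (corner F (sourceIndex o F) 0 (ε 0)) k -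
          vertexZ (corner F (sourceIndex o F) 0 !(ε 0)) k +
        (vertexZ (corner F (sourceIndex o F) 1 (ε 1)) k -
          vertexZ (corner F (sourceIndex o F) 1 !(ε 1)) k) +
        (vertexZ (corner F (sourceIndex o F) 2 (ε 2)) k -
          vertexZ (corner F (sourceIndex o F) 2 !(ε 2)) k)) := by exact_mod_cast this
    rw [h2]
    rcases ε 0 <;> rcases ε 1 <;> rcases ε 2 <;> simp
  have h1 := congrArg (fun v => p ⬝ᵥ v) hvec
  simp only [dotProduct_add, dotProduct_smul, smul_eq_mul, Fin.sum_univ_three] at h1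
  rw [hε 0, hε 1, hε 2]
  have h2 := hF F'
  linarith

/-- Weights on the configuration with given weights of the vertices of the prism over a facet and of
the two apices. -/
noncomputable def facetWeight (o : OrientIndex) (F : Fin 24) (u : PrismWeight) (a b : ℝ) :
    Label → ℝ
  | (some x, l) =>
    Function.extend (fun c : Fin 3 × Bool => facetVtx o F c.1 c.2) (fun c => u c.1 c.2 l) 0 x
  | (none, l) => if l then b else a

theorem facetVtx_injective (o : OrientIndex) (F : Fin 24) :
    Function.Injective fun c : Fin 3 × Bool => facetVtx o F c.1 c.2 := fun _ _ h =>
  Prod.ext (facetVtx_inj.1 h).1 (facetVtx_inj.1 h).2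

theorem facetWeight_facetVtx (u : PrismWeight) (a b : ℝ) (i : Fin 3) (c l : Bool) :
    facetWeight o F u a b (some (facetVtx o F i c), l) = u i c l := by
  rw [facetWeight]
  exact (facetVtx_injective o F).extend_apply (fun c => u c.1 c.2 l) 0 (i, c)

theorem facetWeight_of_not_inFacet (u : PrismWeight) (a b : ℝ) {x : Fin 24} (l : Bool)
    (hx : ¬ InFacet x F) : facetWeight o F u a b (some x, l) = 0 := by
  rw [facetWeight, Function.extend_apply']
  · rfl
  · rintro ⟨c, rfl⟩
    exact hx inFacet_facetVtx

theorem prismWeight_facetWeight (u : PrismWeight) (a b : ℝ) :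
    prismWeight o F (facetWeight o F u a b) = u := by
  funext i c l
  exact facetWeight_facetVtx u a b i c l

/-- The support of weights of one of the three types is a cell. -/
theorem isCell_facetWeight {u : PrismWeight} {a b : ℝ}
    (hu : IsLower (D (false, F)) u ∨ IsUpper (D (true, F)) u ∨ IsMiddle (Equator o F) u)
    (ha : a ≠ 0 → ∀ i c, u i c true = 0) :
    IsCell o D F (Finset.univ.filter fun i => facetWeight o F u a b i ≠ 0) := by
  have hF : ∀ {x l}, facetWeight o F u a b (some x, l) ≠ 0 → InFacet x F := fun {x l} h => by
    by_contra hx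
    exact h (facetWeight_of_not_inFacet u a b l hx)
  have hex : ∀ {x l}, facetWeight o F u a b (some x, l) ≠ 0 →
      ∃ i c, x = facetVtx o F i c ∧ u i c l ≠ 0 := fun {x l} h => by
    obtain ⟨i, c, rfl⟩ := (hF h).exists_facetVtx o
    exact ⟨i, c, rfl, by rwa [facetWeight_facetVtx] at h⟩
  have hlow : IsLower (D (false, F)) u → ∀ {i c}, u i c true ≠ 0 → i = 0 ∧ c = true := by
    intro hu i c h
    by_cases hi : i = 0
    · subst hi
      cases c
      · exact absurd hu.source h
      · exact ⟨rfl, rfl⟩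
    · exact absurd (hu.upper i hi c) h
  have hupp : IsUpper (D (true, F)) u → ∀ {i c}, u i c false ≠ 0 → i = 0 ∧ c = false := by
    intro hu i c h
    by_cases hi : i = 0
    · subst hi
      cases c
      · exact ⟨rfl, rfl⟩
      · exact absurd hu.sink h
    · exact absurd (hu.lower i hi c) h
  refine ⟨fun h => hF (Finset.mem_filter.1 h).2, fun h x hx => ?_, fun {x y} hxy hx hy => ?_,
    fun {i l} h1 h2 => ?_, fun {i c} h1 h2 => ?_⟩
  · obtain ⟨i, c, -, hc⟩ := hex (Finset.mem_filter.1 hx).2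
    have ha' := (Finset.mem_filter.1 h).2
    exact hc (ha (by simpa [facetWeight] using ha') i c)
  · obtain ⟨i, c, rfl, hu1⟩ := hex (Finset.mem_filter.1 hx).2
    obtain ⟨j, c', rfl, hu2⟩ := hex (Finset.mem_filter.1 hy).2
    rcases hu with hu | hu | hu
    · obtain ⟨rfl, rfl⟩ := hlow hu hu1
      exact not_dirEdge_of_sink hxy
    · obtain ⟨rfl, rfl⟩ := hupp hu hu2
      exact not_dirEdge_of_source hxy
    · by_cases hi : i = 0
      · subst hi
        cases c
        · exact hu1 hu.source
        · exact not_dirEdge_of_sink hxy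
      by_cases hj : j = 0
      · subst hj
        cases c'
        · exact not_dirEdge_of_source hxy
        · exact hu2 hu.sink
      have hij : i ≠ j := cellAdj_facetVtx.1 hxy.1
      obtain ⟨rfl, rfl⟩ | ⟨rfl, rfl⟩ : (i = 1 ∧ j = 2) ∨ (i = 2 ∧ j = 1) := by omega
      · exact (hu.pos c c' hxy).elim hu1 hu2
      · exact (hu.neg c' c hxy.not_directed).elim hu1 hu2
  · have h1 := (Finset.mem_filter.1 h1).2
    have h2 := (Finset.mem_filter.1 h2).2
    rw [facetWeight_facetVtx] at h1 h2
    rcases hu with hu | hu | hu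
    · cases l
      · refine ⟨?_, fun y hy => ?_⟩
        · by_contra hi
          exact (hu.axis i (Ne.symm hi)).elim h1 h2
        · obtain ⟨j, c, rfl, hc⟩ := hex (Finset.mem_filter.1 hy).2
          obtain ⟨rfl, rfl⟩ := hlow hu hc
          rfl
      · exact absurd (hlow hu h1).2 (by simp)
    · cases l
      · exact absurd (hupp hu h2).2 (by simp)
      · refine ⟨?_, fun y hy => ?_⟩
        · by_contra hi
          exact (hu.axis i (Ne.symm hi)).elim h1 h2
        · obtain ⟨j, c, rfl, hc⟩ := hex (Finset.mem_filter.1 hy).2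
          obtain ⟨rfl, rfl⟩ := hupp hu hc
          rfl
    · exfalso
      by_cases hi : i = 0
      · subst hi
        cases l
        · exact h2 hu.sink
        · exact h1 hu.source
      · exact (hu.axis i hi).elim (fun h => h1 (h l)) fun h => h2 (h l)
  · have h1 := (Finset.mem_filter.1 h1).2
    have h2 := (Finset.mem_filter.1 h2).2
    rw [facetWeight_facetVtx] at h1 h2
    rcases hu with hu | hu | hu
    · have := hlow hu h2
      simpa using this
    · exact hupp hu h1
    · by_cases hi : i = 0
      · subst hi
        cases c
        · exact ⟨rfl, rfl⟩
        · exact absurd hu.sink h1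
      · exfalso
        cases c
        · exact (hu.axis i hi).elim (fun h => h1 (h false)) fun h => h2 (h true)
        · exact (hu.axis i hi).elim (fun h => h2 (h true)) fun h => h1 (h false)

theorem sum_smul_facetWeight_fst (u : PrismWeight) (a b : ℝ) (p : Fin 4 → ℝ)
    (hm : u.col 0 false + u.col 0 true + (u.col 1 false + u.col 1 true) +
      (u.col 2 false + u.col 2 true) = p ⬝ᵥ centerR F / 2)
    (hX : ∀ i, u.col i true - u.col i false = p ⬝ᵥ axisR o F i / 4) :
    (∑ i, facetWeight o F u a b i • location α β i).1 = p := by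
  obtain ⟨a1, a2, a3, -⟩ := sum_smul_location_coordinates (o := o) (F := F) (α := α) (β := β)
    (w := facetWeight o F u a b) (fun x l => facetWeight_of_not_inFacet u a b l)
  rw [prismWeight_facetWeight] at a2 a3
  rw [facet_expansion o F p, facet_expansion o F (∑ i, facetWeight o F u a b i • location α β i).1,
    a1, a3, hm]
  congr 1
  · congr 1
    ring
  · refine Finset.sum_congr rfl fun i _ => ?_
    rw [a2, hX]
    congr 1
    ring

/-- Bounds for the points of the polytope in terms of the functional that is constant on a facet. -/
theorem convexHull_bounds (hα : α < 0) (hβ : 1 < β) {q : (Fin 4 → ℝ) × ℝ}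
    (hq : q ∈ convexHull ℝ (movedA50 α β)) (F : Fin 24) :
    q.1 ⬝ᵥ centerR F / 2 ≤ 1 ∧ α * (1 - q.1 ⬝ᵥ centerR F / 2) ≤ q.2 ∧
      q.2 ≤ β - (β - 1) * (q.1 ⬝ᵥ centerR F / 2) := by
  have h : α < β := by linarith
  have hA : movedA50 α β = (Finset.univ.map (locate h) : Set ((Fin 4 → ℝ) × ℝ)) := by
    rw [← range_location]
    simp [locate]
  rw [hA, mem_convexHull_map_iff] at hq
  obtain ⟨w, h0, -, h1, rfl⟩ := hq
  change (∑ i, w i • location α β i).1 ⬝ᵥ centerR F / 2 ≤ 1 ∧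
    α * (1 - (∑ i, w i • location α β i).1 ⬝ᵥ centerR F / 2) ≤ (∑ i, w i • location α β i).2 ∧
    (∑ i, w i • location α β i).2 ≤ β - (β - 1) * ((∑ i, w i • location α β i).1 ⬝ᵥ centerR F / 2)
  have hle : (∑ i, w i • location α β i).1 ⬝ᵥ centerR F / 2 ≤ ∑ x, columnWeight w x := by
    rw [sum_smul_location_fst_dot, Finset.sum_div]
    refine Finset.sum_le_sum fun x _ => ?_
    have := mul_le_mul_of_nonneg_left (dot_centerR_le x F) (columnWeight_nonneg h0 x)
    linarith
  rw [sum_weights] at h1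
  rw [sum_smul_location_snd]
  have hH0 : 0 ≤ ∑ x, w (some x, true) := Finset.sum_nonneg fun _ _ => h0 _
  have hH1 : ∑ x, w (some x, true) ≤ ∑ x, columnWeight w x :=
    Finset.sum_le_sum fun x _ => le_add_of_nonneg_left (h0 _)
  have ha := h0 (none, false)
  have hb := h0 (none, true)
  set g := (∑ i, w i • location α β i).1 ⬝ᵥ centerR F / 2
  set M := ∑ x, columnWeight w x
  refine ⟨by linarith, ?_, ?_⟩
  · nlinarith
  · nlinarith

theorem exists_cell_of_mem_convexHull (hα : α < 0) (hβ : 1 < β) (h : α < β) (o : OrientIndex)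
    (D : Diagonals) {q : (Fin 4 → ℝ) × ℝ} (hq : q ∈ convexHull ℝ (movedA50 α β)) :
    ∃ σ ∈ cells o D, q ∈ convexHull ℝ (σ.map (locate h) : Set ((Fin 4 → ℝ) × ℝ)) := by
  obtain ⟨F, hF⟩ := exists_facet_cone o q.1
  obtain ⟨hm1, hlo, hhi⟩ := convexHull_bounds hα hβ hq F
  set m := q.1 ⬝ᵥ centerR F / 2 with hm
  have hm0 : 0 ≤ m := (by positivity : (0 : ℝ) ≤ _).trans hF
  have hba : 0 < β - α := sub_pos.2 h
  -- The height of the part over the facet and the weights of the two apices.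
  obtain ⟨t, a, b, ht0, ht1, ha0, hb0, hab, hq2, hta⟩ : ∃ t a b : ℝ, 0 ≤ t ∧ t ≤ m ∧ 0 ≤ a ∧ 0 ≤ b ∧
      m + (a + b) = 1 ∧ t + (a * α + b * β) = q.2 ∧ (a ≠ 0 → t = 0) := by
    rcases le_total 0 (q.2 - β * (1 - m)) with hd | hd
    · exact ⟨q.2 - β * (1 - m), 0, 1 - m, hd, by linarith, le_rfl, by linarith, by ring, by ring,
        fun h => absurd rfl h⟩
    · have e : (β * (1 - m) - q.2) / (β - α) * (β - α) = β * (1 - m) - q.2 :=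
        div_mul_cancel₀ _ hba.ne'
      have ha : (β * (1 - m) - q.2) / (β - α) ≤ 1 - m := by
        rw [div_le_iff₀ hba]
        linarith
      refine ⟨0, (β * (1 - m) - q.2) / (β - α), 1 - m - (β * (1 - m) - q.2) / (β - α), le_rfl, hm0,
        div_nonneg (by linarith) hba.le, by linarith, by ring, ?_, fun _ => rfl⟩
      linarith
  obtain ⟨u, hu0, hu, hX, hum, hut⟩ := prism_exists (D (false, F)) (D (true, F)) (Equator o F)
    (X := fun i => q.1 ⬝ᵥ axisR o F i / 4) hF ht0 ht1
  have ha : a ≠ 0 → ∀ i c, u i c true = 0 := by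
    intro ha i c
    have := hta ha
    have n := hu0
    have n1 := n 0 false true
    have n2 := n 0 true true
    have n3 := n 1 false true
    have n4 := n 1 true true
    have n5 := n 2 false true
    have n6 := n 2 true true
    fin_cases i <;> cases c <;> simp only [Fin.zero_eta, Fin.mk_one, Fin.reduceFinMk] <;> linarith
  refine ⟨_, ⟨F, isCell_facetWeight (a := a) (b := b) hu ha⟩, ?_⟩
  obtain ⟨-, -, a3, a4⟩ := sum_smul_location_coordinates (o := o) (F := F) (α := α) (β := β)
    (w := facetWeight o F u a b) (fun x l => facetWeight_of_not_inFacet u a b l)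
  rw [prismWeight_facetWeight] at a3 a4
  refine mem_convexHull_map_iff.2 ⟨facetWeight o F u a b, ?_, fun i hi => by simpa using hi, ?_, ?_⟩
  · rintro ⟨_ | x, l⟩
    · cases l <;> simpa [facetWeight]
    · by_cases hx : InFacet x F
      · obtain ⟨i, c, rfl⟩ := hx.exists_facetVtx o
        rw [facetWeight_facetVtx]
        exact hu0 i c l
      · rw [facetWeight_of_not_inFacet u a b l hx]
  · rw [sum_weights, a3, hum]
    simpa [facetWeight] using hab
  · change ∑ i, facetWeight o F u a b i • location α β i = q
    refine Prod.ext (sum_smul_facetWeight_fst u a b q.1 hum hX) ?_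
    rw [sum_smul_location_snd, a4, hut]
    simpa [facetWeight] using hq2

end Cover

/-! ### Exchanging the diagonals of a facet by flips -/

section FacetFlips

variable {o : OrientIndex} {D D' : Diagonals} {F F' : Fin 24} {l : Bool} {i j k : Fin 3}
  {σ R : Finset Label}

/-- The ends of an axis of a facet at a given level. -/
noncomputable def axisEnds (o : OrientIndex) (F : Fin 24) (l : Bool) (i : Fin 3) : Finset Label :=
  {(some (facetVtx o F i false), l), (some (facetVtx o F i true), l)}

theorem axisEnds_subset : axisEnds o F l i ⊆ σ ↔
    (some (facetVtx o F i false), l) ∈ σ ∧ (some (facetVtx o F i true), l) ∈ σ := by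
  simp [axisEnds, Finset.insert_subset_iff]

theorem mem_axisEnds {x : Label} : x ∈ axisEnds o F l i ↔ ∃ b, x = (some (facetVtx o F i b), l) := by
  simp [axisEnds]

theorem disjoint_axisEnds (h : i ≠ j) : Disjoint (axisEnds o F l i) (axisEnds o F l j) := by
  rw [Finset.disjoint_left]
  rintro _ h1 h2
  obtain ⟨b, rfl⟩ := mem_axisEnds.1 h1
  obtain ⟨b', hb⟩ := mem_axisEnds.1 h2
  exact h (facetVtx_inj.1 (Option.some.inj (Prod.mk.inj hb).1)).1

theorem axisEnds_inter_convexHull {α β : ℝ} (h : α < β) (o : OrientIndex) (F : Fin 24) (l : Bool)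
    (i j : Fin 3) :
    (convexHull ℝ ((axisEnds o F l i).map (locate h) : Set ((Fin 4 → ℝ) × ℝ)) ∩
      convexHull ℝ ((axisEnds o F l j).map (locate h) : Set ((Fin 4 → ℝ) × ℝ))).Nonempty := by
  have key : ∀ i, (centerR F, if l then (1 : ℝ) else 0) ∈
      convexHull ℝ ((axisEnds o F l i).map (locate h) : Set ((Fin 4 → ℝ) × ℝ)) := by
    intro i
    have hm := half_add_half_mem_convexHull h (mem_axisEnds.2 ⟨false, rfl⟩ :
      (some (facetVtx o F i false), l) ∈ axisEnds o F l i) (mem_axisEnds.2 ⟨true, rfl⟩)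
    convert hm using 1
    refine Prod.ext ?_ ?_
    · simp only [location, Prod.smul_mk, Prod.mk_add_mk, ← smul_add, vertexR_facetVtx_add, smul_smul]
      norm_num
    · simp only [location, Prod.smul_mk, Prod.mk_add_mk, smul_eq_mul]
      ring
  exact ⟨_, key i, key j⟩

theorem IsCell.eq_facet (h : IsCell o D F' σ) (hσ : axisEnds o F l i ⊆ σ) : F' = F :=
  eq_of_inFacet_facetVtx (h.inFacet (axisEnds_subset.1 hσ).1) (h.inFacet (axisEnds_subset.1 hσ).2)

theorem diagonals_eq_of_axisEnds_subset (h : σ ∈ cells o D) (hσ : axisEnds o F l i ⊆ σ) :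
    D (l, F) = i := by
  obtain ⟨F', h⟩ := h
  obtain rfl := h.eq_facet hσ
  exact (h.antipodes (axisEnds_subset.1 hσ).1 (axisEnds_subset.1 hσ).2).1

/-- The common link of the flip that replaces one of the axes `j` and `k` by the other one as the
diagonal of the copy of the facet `F` at the level `l`. Besides the vertices of `F` at the level `l`
outside of these axes, it involves the lower source or the upper sink, and the apices. -/
structure IsFlipLink (o : OrientIndex) (F : Fin 24) (l : Bool) (j k : Fin 3) (R : Finset Label) :
    Prop where
  same_level : ∀ {x}, (some x, l) ∈ R → ∃ i b, x = facetVtx o F i b ∧ i ≠ j ∧ i ≠ k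
  other_level : ∀ {x}, (some x, !l) ∈ R → x = facetVtx o F 0 (!l)
  antipodes : ∀ {i}, ¬ axisEnds o F l i ⊆ R
  apex : (none, false) ∈ R → l = false ∧ ∀ x, (some x, true) ∉ R

theorem IsFlipLink.symm (h : IsFlipLink o F l j k R) : IsFlipLink o F l k j R where
  same_level hx := by
    obtain ⟨i, b, hx, hj, hk⟩ := h.same_level hx
    exact ⟨i, b, hx, hk, hj⟩
  other_level := h.other_level
  antipodes := h.antipodes
  apex := h.apex

theorem isFlipLink_empty : IsFlipLink o F l j k ∅ where
  same_level hx := by simp at hx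
  other_level hx := by simp at hx
  antipodes := by simp [axisEnds]
  apex hx := by simp at hx

theorem IsFlipLink.disjoint (h : IsFlipLink o F l j k R) :
    Disjoint R (axisEnds o F l k ∪ axisEnds o F l j) := by
  rw [Finset.disjoint_left]
  intro x hR hx
  obtain ⟨i, hi, b, rfl⟩ : ∃ i, (i = k ∨ i = j) ∧ ∃ b, x = (some (facetVtx o F i b), l) :=
    (Finset.mem_union.1 hx).elim (fun h => ⟨k, .inl rfl, mem_axisEnds.1 h⟩)
      fun h => ⟨j, .inr rfl, mem_axisEnds.1 h⟩
  obtain ⟨i', b', he, hj, hk⟩ := h.same_level hR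
  obtain ⟨rfl, -⟩ := facetVtx_inj.1 he
  exact hi.elim hk hj

theorem IsCell.isFlipLink (h : IsCell o D F σ) (hj : axisEnds o F l j ⊆ σ) :
    IsFlipLink o F l j k (σ \ (axisEnds o F l k ∪ axisEnds o F l j)) where
  same_level {x} hx := by
    obtain ⟨h1, h2⟩ := Finset.mem_sdiff.1 hx
    obtain ⟨i, b, rfl⟩ := (h.inFacet h1).exists_facetVtx o
    refine ⟨i, b, rfl, ?_, ?_⟩
    · rintro rfl
      exact h2 (Finset.mem_union_right _ (mem_axisEnds.2 ⟨b, rfl⟩))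
    · rintro rfl
      exact h2 (Finset.mem_union_left _ (mem_axisEnds.2 ⟨b, rfl⟩))
  other_level hx :=
    (h.antipodes (axisEnds_subset.1 hj).1 (axisEnds_subset.1 hj).2).2 _ (Finset.mem_sdiff.1 hx).1
  antipodes {i} hi := by
    have e1 := diagonals_eq_of_axisEnds_subset ⟨F, h⟩ hj
    have e2 := diagonals_eq_of_axisEnds_subset ⟨F, h⟩ (hi.trans Finset.sdiff_subset)
    obtain rfl : i = j := e2.symm.trans e1
    exact (Finset.mem_sdiff.1 (axisEnds_subset.1 hi).1).2
      (Finset.mem_union_right _ (mem_axisEnds.2 ⟨false, rfl⟩))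
  apex ha := by
    replace ha := (Finset.mem_sdiff.1 ha).1
    refine ⟨?_, fun x hx => h.apex ha x (Finset.mem_sdiff.1 hx).1⟩
    cases l
    · rfl
    · exact absurd (axisEnds_subset.1 hj).1 (h.apex ha _)

theorem IsFlipLink.isCell (hD : D (l, F) = j) (hj : axisEnds o F l j ⊆ σ)
    (hk : ¬ axisEnds o F l k ⊆ σ)
    (h : IsFlipLink o F l j k (σ \ (axisEnds o F l k ∪ axisEnds o F l j))) : IsCell o D F σ := by
  have hZ : ∀ {x}, x ∈ axisEnds o F l k ∪ axisEnds o F l j → ∃ i b, x = (some (facetVtx o F i b), l) :=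
    fun hx => (Finset.mem_union.1 hx).elim (fun h => ⟨k, mem_axisEnds.1 h⟩)
      fun h => ⟨j, mem_axisEnds.1 h⟩
  have hother : ∀ {x}, (some x, !l) ∈ σ → x = facetVtx o F 0 (!l) := fun {x} hx => by
    refine h.other_level (Finset.mem_sdiff.2 ⟨hx, fun hz => ?_⟩)
    obtain ⟨i, b, hb⟩ := hZ hz
    simpa using congrArg Prod.snd hb
  have hF : ∀ {x l'}, (some x, l') ∈ σ → InFacet x F := fun {x l'} hx => by
    by_cases hl : l' = l
    · subst hl
      by_cases hz : (some x, l') ∈ axisEnds o F l' k ∪ axisEnds o F l' j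
      · obtain ⟨i, b, hb⟩ := hZ hz
        rw [Option.some.inj (congrArg Prod.fst hb)]
        exact inFacet_facetVtx
      · obtain ⟨i, b, rfl, -⟩ := h.same_level (Finset.mem_sdiff.2 ⟨hx, hz⟩)
        exact inFacet_facetVtx
    · obtain rfl : l' = !l := by cases l <;> cases l' <;> simp_all
      rw [hother hx]
      exact inFacet_facetVtx
  refine ⟨hF, fun ha x hx => ?_, fun {x y} hxy hx hy => ?_, fun {i l'} h1 h2 => ?_,
    fun {i b} h1 h2 => ?_⟩
  · have ha' : (none, false) ∈ σ \ (axisEnds o F l k ∪ axisEnds o F l j) := by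
      refine Finset.mem_sdiff.2 ⟨ha, fun hz => ?_⟩
      obtain ⟨i, b, hb⟩ := hZ hz
      simpa using congrArg Prod.fst hb
    obtain ⟨rfl, hup⟩ := h.apex ha'
    refine hup x (Finset.mem_sdiff.2 ⟨hx, fun hz => ?_⟩)
    obtain ⟨i, b, hb⟩ := hZ hz
    simpa using congrArg Prod.snd hb
  · cases l
    · obtain rfl := hother hx
      obtain ⟨i, b, rfl⟩ := (hF hy).exists_facetVtx o
      exact not_dirEdge_of_sink hxy
    · obtain rfl := hother hy
      obtain ⟨i, b, rfl⟩ := (hF hx).exists_facetVtx o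
      exact not_dirEdge_of_source hxy
  · by_cases hl : l' = l
    · subst hl
      refine ⟨?_, fun y hy => hother hy⟩
      rw [hD]
      by_contra hij
      have hik : i ≠ k := by
        rintro rfl
        exact hk (axisEnds_subset.2 ⟨h1, h2⟩)
      refine h.antipodes (i := i) fun x hx => Finset.mem_sdiff.2
        ⟨axisEnds_subset.2 ⟨h1, h2⟩ hx, fun hz => ?_⟩
      exact (Finset.mem_union.1 hz).elim (Finset.disjoint_left.1 (disjoint_axisEnds hik) hx)
        (Finset.disjoint_left.1 (disjoint_axisEnds (Ne.symm hij)) hx)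
    · obtain rfl : l' = !l := by cases l <;> cases l' <;> simp_all
      have e := (hother h1).trans (hother h2).symm
      simpa using (facetVtx_inj.1 e).2
  · cases l
    · simpa using facetVtx_inj.1 (hother h2)
    · exact facetVtx_inj.1 (hother h1)

/-- The cells that contain the chosen diagonal of a facet. -/
theorem mem_cells_iff_of_axisEnds_subset (hD : D (l, F) = j) (hjk : j ≠ k)
    (hj : axisEnds o F l j ⊆ σ) : σ ∈ cells o D ↔ ¬ axisEnds o F l k ⊆ σ ∧
      IsFlipLink o F l j k (σ \ (axisEnds o F l k ∪ axisEnds o F l j)) := by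
  constructor
  · intro h
    refine ⟨fun hk => hjk (hD.symm.trans (diagonals_eq_of_axisEnds_subset h hk)), ?_⟩
    obtain ⟨F', h⟩ := h
    obtain rfl := h.eq_facet hj
    exact h.isFlipLink hj
  · rintro ⟨hk, h⟩
    exact ⟨F, h.isCell hD hj hk⟩

theorem mem_cells_of_eq_off (hDD : ∀ a, a ≠ (l, F) → D a = D' a)
    (hσ : ¬ axisEnds o F l (D (l, F)) ⊆ σ) (h : σ ∈ cells o D) : σ ∈ cells o D' := by
  obtain ⟨F', h⟩ := h
  refine ⟨F', h.inFacet, h.apex, h.edge, fun {i l'} h1 h2 => ?_, h.mixed⟩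
  obtain ⟨e1, e2⟩ := h.antipodes h1 h2
  refine ⟨?_, e2⟩
  rw [← hDD, e1]
  intro he
  obtain ⟨rfl, rfl⟩ := Prod.mk.inj he
  rw [e1] at hσ
  exact hσ (axisEnds_subset.2 ⟨h1, h2⟩)

/-- Changing the diagonal of one copy of one facet is a flip. -/
theorem isFlip_update {α β : ℝ} (h : α < β) (o : OrientIndex) (D : Diagonals) {l : Bool}
    {F : Fin 24} {k : Fin 3} (hk : D (l, F) ≠ k) :
    IsFlip (movedA50 α β)
      (realization (locate h) (cells o D) (isLowerSet_cells o D) (uniqueWeights_cells h o D))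
      (realization (locate h) (cells o (Function.update D (l, F) k)) (isLowerSet_cells o _)
        (uniqueWeights_cells h o _)) := by
  have hD' : Function.update D (l, F) k (l, F) = k := Function.update_self ..
  have hoff : ∀ a, a ≠ (l, F) → D a = Function.update D (l, F) k a :=
    fun a ha => (Function.update_of_ne ha k D).symm
  refine isFlip_realization (P := axisEnds o F l k) (N := axisEnds o F l (D (l, F)))
    (L := {R | IsFlipLink o F l (D (l, F)) k R}) location_mem (disjoint_axisEnds hk.symm)
    (axisEnds_inter_convexHull h o F l _ _) isFlipLink_empty (fun R hR => IsFlipLink.disjoint hR)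
    (fun σ hσ => mem_cells_iff_of_axisEnds_subset rfl hk hσ) (fun σ hσ => ?_)
    (fun hmem => hk (diagonals_eq_of_axisEnds_subset hmem subset_rfl))
    (fun hmem => hk.symm (hD'.symm.trans (diagonals_eq_of_axisEnds_subset hmem subset_rfl)))
    fun σ h1 h2 => ⟨mem_cells_of_eq_off hoff h2,
      mem_cells_of_eq_off (fun a ha => (hoff a ha).symm) (by rwa [hD'])⟩
  rw [mem_cells_iff_of_axisEnds_subset hD' hk.symm hσ, Finset.union_comm (axisEnds o F l k)]
  exact and_congr_right fun _ => ⟨IsFlipLink.symm, IsFlipLink.symm⟩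

end FacetFlips

/-! ### Components of the graph of triangulations -/

section Components

variable {α β : ℝ}

/-- The triangulation of the configuration given by an orientation and diagonals. -/
noncomputable def cellTriangulation (hα : α < 0) (hβ : 1 < β) (o : OrientIndex) (D : Diagonals) :
    Triangulation (movedA50 α β) :=
  have h : α < β := by linarith
  ⟨realization (locate h) (cells o D) (isLowerSet_cells o D) (uniqueWeights_cells h o D),
    isTriangulation_realization (range_location α β)
      fun _ hq => exists_cell_of_mem_convexHull hα hβ h o D hq⟩

variable (hα : α < 0) (hβ : 1 < β)

theorem map_mem_faces_cellTriangulation (h : α < β) {o : OrientIndex} {D : Diagonals}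
    {σ : Finset Label} : σ.map (locate h) ∈ (cellTriangulation hα hβ o D).1.faces ↔
      σ.Nonempty ∧ σ ∈ cells o D :=
  map_mem_realization_faces (hK := isLowerSet_cells o D) (hU := uniqueWeights_cells h o D)

theorem axisEnds_mem_cells (o : OrientIndex) (D : Diagonals) (l : Bool) (F : Fin 24) :
    axisEnds o F l (D (l, F)) ∈ cells o D := by
  obtain ⟨k, hk⟩ := exists_ne (D (l, F))
  refine (mem_cells_iff_of_axisEnds_subset rfl hk.symm subset_rfl).2 ⟨fun hs => ?_, ?_⟩
  · have hmem : (some (facetVtx o F k false), l) ∈ axisEnds o F l k := mem_axisEnds.2 ⟨false, rfl⟩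
    exact Finset.disjoint_left.1 (disjoint_axisEnds hk) hmem (hs hmem)
  · rw [Finset.sdiff_eq_empty_iff_subset.2 Finset.subset_union_right]
    exact isFlipLink_empty

theorem cellTriangulation_injective (o : OrientIndex) :
    Function.Injective (cellTriangulation hα hβ o) := by
  have h : α < β := by linarith
  intro D D' hDD
  funext ⟨l, F⟩
  have h1 := (map_mem_faces_cellTriangulation hα hβ h).2
    ⟨⟨_, mem_axisEnds.2 ⟨false, rfl⟩⟩, axisEnds_mem_cells o D l F⟩
  rw [hDD, map_mem_faces_cellTriangulation] at h1
  exact (diagonals_eq_of_axisEnds_subset h1.2 subset_rfl).symm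

theorem reachable_cellTriangulation (o : OrientIndex) (D D' : Diagonals) :
    (triangulationGraph (movedA50 α β)).Reachable (cellTriangulation hα hβ o D)
      (cellTriangulation hα hβ o D') := by
  have hstep : ∀ (D : Diagonals) a k, (triangulationGraph (movedA50 α β)).Reachable
      (cellTriangulation hα hβ o D) (cellTriangulation hα hβ o (Function.update D a k)) := by
    intro D a k
    by_cases hk : D a = k
    · rw [← hk, Function.update_eq_self]
    · refine SimpleGraph.Adj.reachable ((SimpleGraph.fromRel_adj _ _ _).2
        ⟨fun he => hk ?_, .inl (isFlip_update _ o D hk)⟩)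
      have := congrFun (cellTriangulation_injective hα hβ o he) a
      rwa [Function.update_self] at this
  have hall : ∀ s : Finset (Bool × Fin 24), (triangulationGraph (movedA50 α β)).Reachable
      (cellTriangulation hα hβ o D) (cellTriangulation hα hβ o (s.piecewise D' D)) := by
    intro s
    induction s using Finset.induction_on with
    | empty => rw [Finset.piecewise_empty]
    | insert a s _ ih =>
      rw [Finset.piecewise_insert]
      exact ih.trans (hstep _ _ _)
  simpa using hall Finset.univ

theorem induces_cellTriangulation (h : α < β) (o : OrientIndex) (D : Diagonals) :
    Induces h o (cellTriangulation hα hβ o D).1 := by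
  intro x y hxy
  refine ((cellTriangulation hα hβ o D).2.exists_diagonal h hxy.1).resolve_right fun hyx => ?_
  obtain ⟨-, F, hF⟩ := (map_mem_faces_cellTriangulation hα hβ h).1 hyx
  exact hF.edge hxy (by simp [diagonal]) (by simp [diagonal])

/-- Triangulations that induce distinct orientations are not connected by flips, because one of the
two orientations is symplectic. -/
theorem eq_of_reachable_cellTriangulation {o o' : OrientIndex} {D D' : Diagonals}
    (hr : (triangulationGraph (movedA50 α β)).Reachable (cellTriangulation hα hβ o D)
      (cellTriangulation hα hβ o' D')) : o = o' := by
  have h : α < β := by linarith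
  have key : ∀ {m o' D D'}, (triangulationGraph (movedA50 α β)).Reachable
      (cellTriangulation hα hβ (some m) D) (cellTriangulation hα hβ o' D') → some m = o' := by
    intro m o' D D' hr
    by_contra hne
    obtain ⟨x, y, hxy, hyx⟩ := exists_directed_of_ne _ _ hne
    have h1 := (induces_cellTriangulation hα hβ h (some m) D).of_reachable h hr
    exact not_both_diagonals h hxy.1.ne (h1 x y hxy)
      (induces_cellTriangulation hα hβ h o' D' y x hyx)
  cases o with
  | some m => exact key hr
  | none =>
    cases o' with
    | some m => exact (key hr.symm).symm
    | none => rfl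

/-! ### Convex position -/

theorem notMem_convexHull_of_lt {E : Type*} [AddCommGroup E] [Module ℝ E] {A : Set E} {x : E}
    (f : E →ₗ[ℝ] ℝ) (hf : ∀ y ∈ A, y ≠ x → f y < f x) : x ∉ convexHull ℝ (A \ {x}) := fun hx =>
  lt_irrefl (f x) (convexHull_min (t := {y | f y < f x}) (fun y hy => hf y hy.1 hy.2)
    (convex_halfSpace_lt f.isLinear (f x)) hx)

/-- Every point of the configuration is the unique maximum of a linear functional. -/
theorem convexIndependent_movedA50 (hα : α < 0) (hβ : 1 < β) :
    ConvexIndependent ℝ ((↑) : movedA50 α β → (Fin 4 → ℝ) × ℝ) := by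
  rw [convexIndependent_set_iff_notMem_convexHull_sdiff]
  rw [← range_location]
  rintro _ ⟨⟨_ | x, l⟩, rfl⟩
  · refine notMem_convexHull_of_lt ((if l then 1 else -1 : ℝ) • LinearMap.snd ℝ (Fin 4 → ℝ) ℝ) ?_
    rintro _ ⟨⟨_ | y, l'⟩, rfl⟩ hne
    · cases l <;> cases l' <;> simp [location] at hne ⊢ <;> linarith
    · cases l <;> cases l' <;> simp [location] at hne ⊢ <;> linarith
  -- The multiple of the inner product with `x` is large enough to dominate the heights.
  · set K : ℝ := 1 + |α| + |β|
    have h1 := abs_nonneg α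
    have h2 := abs_nonneg β
    have h3 := neg_abs_le α
    have h4 := le_abs_self β
    set f : (Fin 4 → ℝ) × ℝ →ₗ[ℝ] ℝ :=
      K • (dotProductBilin ℝ ℝ (vertexR x)).comp (LinearMap.fst ℝ (Fin 4 → ℝ) ℝ) +
        (if l then 1 else -1 : ℝ) • LinearMap.snd ℝ (Fin 4 → ℝ) ℝ with hf
    have hfv : ∀ q, f q = K * (vertexR x ⬝ᵥ q.1) + (if l then 1 else -1) * q.2 := fun q => rfl
    refine notMem_convexHull_of_lt f ?_
    rintro _ ⟨⟨_ | y, l'⟩, rfl⟩ hne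
    · rw [hfv, hfv]
      cases l <;> cases l' <;> simp [location, vertexR_dot_self] <;> linarith
    · rw [hfv, hfv]
      by_cases hxy : x = y
      · subst hxy
        cases l <;> cases l' <;> simp [location] at hne ⊢
      · have h5 := mul_le_mul_of_nonneg_left (vertexR_dot_le hxy) (by positivity : 0 ≤ K)
        cases l <;> cases l' <;> simp [location, vertexR_dot_self] <;> linarith

end Components

theorem proposition2p5 (α β : ℝ) (hα : α < 0) (hβ : 1 < β) :
    (movedA50 α β).encard = 50 ∧
    ConvexIndependent ℝ ((↑) : movedA50 α β → (Fin 4 → ℝ) × ℝ) ∧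
    13 ≤ {C : (triangulationGraph (movedA50 α β)).ConnectedComponent |
      3 ^ 48 ≤ C.supp.encard}.encard := by
  refine ⟨?_, convexIndependent_movedA50 hα hβ, ?_⟩
  · have h : α < β := by linarith
    rw [← range_location, ← Set.image_univ, (location_injective h).encard_image, Set.encard_univ]
    simp
  · set c : OrientIndex → (triangulationGraph (movedA50 α β)).ConnectedComponent := fun o =>
      (triangulationGraph (movedA50 α β)).connectedComponentMk
        (cellTriangulation hα hβ o fun _ => 0) with hc
    have hinj : Function.Injective c := fun o o' h =>
      eq_of_reachable_cellTriangulation hα hβ (SimpleGraph.ConnectedComponent.eq.1 h)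
    have h13 : (13 : ℕ∞) = ENat.card OrientIndex := by simp
    rw [h13]
    refine hinj.encard_range.trans (Set.encard_le_encard ?_)
    rintro _ ⟨o, rfl⟩
    have h48 : (3 ^ 48 : ℕ∞) = ENat.card Diagonals := by simp; norm_num
    rw [Set.mem_ofPred_eq, h48]
    refine (cellTriangulation_injective hα hβ o).encard_range.trans (Set.encard_le_encard ?_)
    rintro _ ⟨D, rfl⟩
    exact SimpleGraph.ConnectedComponent.eq.2 (reachable_cellTriangulation hα hβ o D _)
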